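/- Let $D$ be a finite set and let $\Gamma$ be a finite set of functions $f : D^{k} \to \{0,1\}$ (each with its own arity $k = k_f$). A map $g : D \to D$ is an endomorphism of $\Gamma$ if for every $f \in \Gamma$ and every $(x_1,\dots,x_k) \in D^{k}$, $f(x_1,\dots,x_k) = 0$ implies $f(g(x_1),\dots,g(x_k)) = 0$; $\Gamma$ is a core if all of its endomorphisms are injective. For a set $\Delta$ of finitary relations on $D$, Min CSP$(\Gamma,\Delta)$ is the following minimisation problem. An instance consists of a finite set $V$ of variables, a sum $\sum_{i=1}^m \rho_i f_i(\mathbf{x}_i)$ with $\rho_i \in \mathbb{Q}_{\ge 0}$, $f_i \in \Gamma$ and $\mathbf{x}_i$ a list of $k_{f_i}$ variables from $V$, and finitely many constraint applications $(\mathbf{y}_j; R_j)$ with $R_j \in \Delta$ and $\mathbf{y}_j$ a list of variables from $V$ of matching length. A solution is a map $\sigma : V \to D$ with $\sigma(\mathbf{y}_j) \in R_j$ for all $j$, and its measure, to be minimised, is $\sum_{i=1}^m \rho_i f_i(\sigma(\mathbf{x}_i))$. Weights are written in binary, as fractions. Write Min CSP$(\Gamma)$ for Min CSP$(\Gamma,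 \emptyset)$, and let $\mathcal{C}_D = \{\{d\} : d \in D\}$ be the set of constant unary relations. A minimisation problem $P$ is polynomial-time reducible to a minimisation problem $Q$ if there are functions $F$ and $G$, computable by Turing machines in polynomial time, such that $F$ maps each instance $I$ of $P$ to an instance $F(I)$ of $Q$ that has a solution whenever $I$ has one, and, for every instance $I$ of $P$ and every optimal solution $s$ of $F(I)$, $G(I,s)$ is an optimal solution of $I$ if $I$ has a solution, and is the answer "unsatisfiable" otherwise. Proposition. If $\Gamma$ is a core, then Min CSP$(\Gamma, \mathcal{C}_D)$ is polynomial-time reducible to Min CSP$(\Gamma)$. -/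

import Mathlib

/-! ## Minimisation problems and polynomial-time reductions -/

/-- `f` is computed by a Turing machine in time polynomial in the length of the encoded input. -/
def PolyTimeComputable {α β A B : Type} (ea : α → List A) (eb : β → List B) (f : α → β) : Prop :=
  Nonempty (Turing.TM2ComputableInPolyTime ea eb f)

/-- A minimisation problem: instances, candidate solutions of each instance, the candidates that
are solutions, their measure, and encodings of instances and candidates as words. -/
structure MinProblem where
  /-- instances -/
  Inst : Type
  /-- candidate solutions of an instance -/
  Cand : Inst → Type
  /-- the candidates that are solutions -/
  IsSol : (I : Inst) → Cand I → Prop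
  /-- the measure of a candidate -/
  measure : (I : Inst) → Cand I → ℚ≥0
  /-- alphabet of the instance encoding -/
  InstSym : Type
  /-- alphabet of the solution encoding -/
  SolSym : Type
  /-- encoding of instances -/
  encInst : Inst → List InstSym
  /-- encoding of candidate solutions -/
  encCand : (I : Inst) → Cand I → List SolSym
  encInst_injective : Function.Injective encInst
  encCand_injective : ∀ I, Function.Injective (encCand I)

namespace MinProblem

/-- The instance has a solution. -/
def Satisfiable (P : MinProblem) (I : P.Inst) : Prop := ∃ s, P.IsSol I s

/-- `s` is a solution of minimum measure. -/
def IsOptSol (P : MinProblem) (I : P.Inst) (s : P.Cand I) : Prop :=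
  P.IsSol I s ∧ ∀ t, P.IsSol I t → P.measure I s ≤ P.measure I t

/-- The word written for an answer to `I`: a candidate solution, or `none` for "unsatisfiable". -/
def encAnswer (P : MinProblem) : (Σ I : P.Inst, Option (P.Cand I)) → List (Option P.SolSym)
  | ⟨_, none⟩ => [none]
  | ⟨I, some s⟩ => (P.encCand I s).map some

/-- The word written for an instance of `P` together with a candidate solution of its image under
`f`. -/
def encPair (P Q : MinProblem) (f : P.Inst → Q.Inst) (p : Σ I : P.Inst, Q.Cand (f I)) :
    List (P.InstSym ⊕ Q.SolSym) :=
  (P.encInst p.1).map Sum.inl ++ (Q.encCand (f p.1) p.2).map Sum.inr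

/-- `P` is polynomial-time reducible to `Q`: a polynomial-time computable `f` maps instances of `P`
to instances of `Q`, satisfiable ones to satisfiable ones, and a polynomial-time computable `g`
turns an instance `I` of `P` and any optimal solution of `f I` into an optimal solution of `I`, or
into the answer "unsatisfiable" if `I` has no solution. -/
def PolyTimeReducible (P Q : MinProblem) : Prop :=
  ∃ (f : P.Inst → Q.Inst) (g : (I : P.Inst) → Q.Cand (f I) → Option (P.Cand I)),
    PolyTimeComputable P.encInst Q.encInst f ∧
    PolyTimeComputable (encPair P Q f) P.encAnswer (fun p => ⟨p.1, g p.1 p.2⟩) ∧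
    ∀ I : P.Inst,
      (P.Satisfiable I → Q.Satisfiable (f I)) ∧
      ∀ s : Q.Cand (f I), Q.IsOptSol (f I) s →
        (P.Satisfiable I → ∃ t, g I s = some t ∧ P.IsOptSol I t) ∧
        (¬ P.Satisfiable I → g I s = none)

end MinProblem

/-! ## Min CSP -/

/-- A `{0,1}`-valued function `D ^ k → {0,1}`, with its arity `k`. -/
abbrev CostFn (D : Type) : Type := Σ k : ℕ, (Fin k → D) → Fin 2

/-- A finitary relation on `D`, with its arity. -/
abbrev FinRel (D : Type) : Type := Σ k : ℕ, Set (Fin k → D)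

/-- The set of constant unary relations `{d}`, `d ∈ D`. -/
def constRels (D : Type) : Set (FinRel D) :=
  Set.range fun d : D => (⟨1, {x | x 0 = d}⟩ : FinRel D)

/-- A map `g : D → D` is an endomorphism of `h` if `h x = 0` implies `h (g ∘ x) = 0`. -/
def IsEndo {D : Type} (h : CostFn D) (g : D → D) : Prop :=
  ∀ x : Fin h.1 → D, h.2 x = 0 → h.2 (g ∘ x) = 0

/-- All endomorphisms of `Γ` are injective. -/
def IsCore {D : Type} (Γ : Set (CostFn D)) : Prop :=
  ∀ g : D → D, (∀ h ∈ Γ, IsEndo h g) → Function.Injective g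

/-- A weighted term `ρ f(x)` over the variables `Fin n`. -/
structure CSPTerm {D : Type} (Γ : Set (CostFn D)) (n : ℕ) where
  /-- the weight -/
  weight : ℚ≥0
  /-- the function -/
  fn : Γ
  /-- the list of variables -/
  args : Fin fn.1.1 → Fin n

/-- A constraint application `(y; R)` over the variables `Fin n`. -/
structure CSPConstraint {D : Type} (Δ : Set (FinRel D)) (n : ℕ) where
  /-- the relation -/
  rel : Δ
  /-- the list of variables -/
  args : Fin rel.1.1 → Fin n

/-- An instance of Min CSP(Γ, Δ): variables, a weighted sum, and constraint applications. -/
structure CSPInst {D : Type} (Γ : Set (CostFn D)) (Δ : Set (FinRel D)) where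
  /-- the number of variables -/
  numVars : ℕ
  /-- the terms of the sum -/
  terms : List (CSPTerm Γ numVars)
  /-- the constraint applications -/
  constraints : List (CSPConstraint Δ numVars)

/-- The alphabet in which instances are written: one symbol for each function of `Γ` and each
relation of `Δ`, binary digits, a tick, and a separator. -/
inductive CSPSym {D : Type} (Γ : Set (CostFn D)) (Δ : Set (FinRel D)) : Type
  | fn (f : Γ)
  | rel (R : Δ)
  | bit (b : Bool)
  | tick
  | sep

namespace CSPInst

variable {D : Type} {Γ : Set (CostFn D)} {Δ : Set (FinRel D)}

/-- The assignment satisfies every constraint application. -/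
def IsSol (I : CSPInst Γ Δ) (σ : Fin I.numVars → D) : Prop :=
  ∀ c ∈ I.constraints, (fun i => σ (c.args i)) ∈ c.rel.1.2

/-- The weighted sum of the instance at the assignment `σ`. -/
def measure (I : CSPInst Γ Δ) (σ : Fin I.numVars → D) : ℚ≥0 :=
  (I.terms.map fun t => t.weight * ((t.fn.1.2 fun i => σ (t.args i)).val : ℚ≥0)).sum

/-- A natural number in binary, least significant digit first. -/
def encNat (m : ℕ) : List (CSPSym Γ Δ) := m.bits.map CSPSym.bit

/-- A list of variables, each preceded by a separator. The variables `0, …, n - 1` are written in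
unary; as the whole set of variables is listed in the instance, this is polynomially equivalent to
writing them in binary. -/
def encArgs {n : ℕ} (l : List (Fin n)) : List (CSPSym Γ Δ) :=
  l.flatMap fun v => CSPSym.sep :: List.replicate v.val CSPSym.tick

/-- A term: the function, the numerator and the denominator of the weight in binary, and the
variables. -/
def encTerm {n : ℕ} (t : CSPTerm Γ n) : List (CSPSym Γ Δ) :=
  CSPSym.fn t.fn :: (encNat t.weight.num ++ CSPSym.sep ::
    (encNat t.weight.den ++ encArgs (List.ofFn t.args)))

/-- A constraint application: the relation and the variables. -/
def encConstraint {n : ℕ} (c : CSPConstraint Δ n) : List (CSPSym Γ Δ) :=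
  CSPSym.rel c.rel :: encArgs (List.ofFn c.args)

/-- An instance: one tick for each variable, then the terms, then the constraint applications. -/
def enc (I : CSPInst Γ Δ) : List (CSPSym Γ Δ) :=
  List.replicate I.numVars CSPSym.tick ++ (I.terms.flatMap encTerm ++
    I.constraints.flatMap encConstraint)

/-! ### The encoding is injective -/

/-- Words without a letter satisfying `p`, followed by a word that is empty or starts with such a
letter, can be split uniquely. -/
theorem split_unique {A : Type} (p : A → Prop) {t t' r r' : List A}
    (ht : ∀ a ∈ t, ¬ p a) (ht' : ∀ a ∈ t', ¬ p a)
    (hr : ∀ a ∈ r.head?, p a) (hr' : ∀ a ∈ r'.head?, p a)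
    (h : t ++ r = t' ++ r') : t = t' ∧ r = r' := by
  induction t generalizing t' with
  | nil =>
    cases t' with
    | nil => exact ⟨rfl, h⟩
    | cons a t' =>
      simp only [List.nil_append] at h
      subst h
      exact absurd (hr a (by simp)) (ht' a (by simp))
  | cons a t ih =>
    cases t' with
    | nil =>
      simp only [List.nil_append] at h
      subst h
      exact absurd (hr' a (by simp)) (ht a (by simp))
    | cons b t' =>
      simp only [List.cons_append, List.cons.injEq] at h
      obtain ⟨rfl, h⟩ := h
      obtain ⟨rfl, rfl⟩ := ih (fun a ha => ht a (by simp [ha])) (fun a ha => ht' a (by simp [ha])) h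
      exact ⟨rfl, rfl⟩

/-- A concatenation of nonempty blocks whose first letter, and no other, satisfies `p` can be split
uniquely. -/
theorem flatMap_unique {A X : Type} (p : A → Prop) (e : X → List A)
    (he : ∀ x, ∃ a t, e x = a :: t ∧ p a ∧ ∀ b ∈ t, ¬ p b) (hinj : Function.Injective e)
    {l l' : List X} (h : l.flatMap e = l'.flatMap e) : l = l' := by
  have hd : ∀ l : List X, ∀ a ∈ (l.flatMap e).head?, p a := by
    intro l a ha
    cases l with
    | nil => simp at ha
    | cons x l =>
      obtain ⟨b, t, hb, hp, -⟩ := he x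
      simp only [List.flatMap_cons, hb, List.cons_append, List.head?_cons, Option.mem_def,
        Option.some.injEq] at ha
      exact ha ▸ hp
  induction l generalizing l' with
  | nil =>
    cases l' with
    | nil => rfl
    | cons x l' =>
      obtain ⟨b, t, hb, -⟩ := he x
      simp [hb] at h
  | cons x l ih =>
    cases l' with
    | nil =>
      obtain ⟨b, t, hb, -⟩ := he x
      simp [hb] at h
    | cons y l' =>
      obtain ⟨b, t, hb, -, ht⟩ := he x
      obtain ⟨c, u, hc, -, hu⟩ := he y
      simp only [List.flatMap_cons, hb, hc, List.cons_append, List.cons.injEq] at h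
      obtain ⟨rfl, h⟩ := h
      obtain ⟨rfl, h2⟩ := split_unique p ht hu (hd l) (hd l') h
      rw [hinj (hb.trans hc.symm), ih h2]

theorem encNat_injective : Function.Injective (encNat : ℕ → List (CSPSym Γ Δ)) := by
  intro a b h
  have hb : a.bits = b.bits :=
    (List.map_injective_iff.2 fun x y hxy => CSPSym.bit.inj hxy) h
  have key : ∀ n : ℕ, n.bits.foldr Nat.bit 0 = n := by
    intro n
    induction n using Nat.binaryRec' with
    | zero => simp
    | bit b n hn ih => rw [Nat.bits_append_bit n b hn]; simp [ih]
  rw [← key a, ← key b, hb]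

theorem encArgs_injective {n : ℕ} :
    Function.Injective (encArgs : List (Fin n) → List (CSPSym Γ Δ)) := by
  intro l l' h
  refine flatMap_unique (fun a => a = CSPSym.sep) _ ?_ ?_ h
  · intro v
    refine ⟨_, _, rfl, rfl, ?_⟩
    intro b hb
    rw [List.eq_of_mem_replicate hb]
    simp
  · intro v w hvw
    have := congrArg List.length hvw
    simp at this
    exact Fin.ext this

theorem encArgs_head {n : ℕ} (l : List (Fin n)) :
    ∀ a ∈ (encArgs l : List (CSPSym Γ Δ)).head?, a = CSPSym.sep := by
  cases l <;> simp [encArgs]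

theorem encNat_ne_sep (m : ℕ) : ∀ a ∈ (encNat m : List (CSPSym Γ Δ)), ¬ a = CSPSym.sep := by
  intro a ha
  simp only [encNat, List.mem_map] at ha
  obtain ⟨b, -, rfl⟩ := ha
  simp

theorem encTerm_injective {n : ℕ} :
    Function.Injective (encTerm : CSPTerm Γ n → List (CSPSym Γ Δ)) := by
  rintro ⟨w, f, x⟩ ⟨w', f', x'⟩ h
  simp only [encTerm, List.cons.injEq, CSPSym.fn.injEq] at h
  obtain ⟨rfl, h⟩ := h
  obtain ⟨h1, h⟩ := split_unique (fun a => a = CSPSym.sep) (encNat_ne_sep _) (encNat_ne_sep _)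
    (by simp) (by simp) h
  simp only [List.cons.injEq, true_and] at h
  obtain ⟨h2, h3⟩ := split_unique (fun a => a = CSPSym.sep) (encNat_ne_sep _) (encNat_ne_sep _)
    (encArgs_head _) (encArgs_head _) h
  obtain rfl := NNRat.ext_num_den (encNat_injective h1) (encNat_injective h2)
  obtain rfl := List.ofFn_injective (encArgs_injective h3)
  rfl

theorem encConstraint_injective {n : ℕ} :
    Function.Injective (encConstraint : CSPConstraint Δ n → List (CSPSym Γ Δ)) := by
  rintro ⟨R, x⟩ ⟨R', x'⟩ h
  simp only [encConstraint, List.cons.injEq, CSPSym.rel.injEq] at h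
  obtain ⟨rfl, h⟩ := h
  obtain rfl := List.ofFn_injective (encArgs_injective h)
  rfl

/-- The letters that start a term or a constraint application. -/
def IsHead (a : CSPSym Γ Δ) : Prop := (∃ f, a = CSPSym.fn f) ∨ ∃ R, a = CSPSym.rel R

theorem not_isHead_of_mem_encArgs {n : ℕ} (l : List (Fin n)) :
    ∀ a ∈ (encArgs l : List (CSPSym Γ Δ)), ¬ IsHead a := by
  intro a ha
  simp only [encArgs, List.mem_flatMap, List.mem_cons, List.mem_replicate] at ha
  obtain ⟨v, -, rfl | ⟨-, rfl⟩⟩ := ha <;> simp [IsHead]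

theorem not_isHead_of_mem_encNat (m : ℕ) :
    ∀ a ∈ (encNat m : List (CSPSym Γ Δ)), ¬ IsHead a := by
  intro a ha
  simp only [encNat, List.mem_map] at ha
  obtain ⟨b, -, rfl⟩ := ha
  simp [IsHead]

/-- A term or a constraint application. -/
def encItem {n : ℕ} : CSPTerm Γ n ⊕ CSPConstraint Δ n → List (CSPSym Γ Δ)
  | Sum.inl t => encTerm t
  | Sum.inr c => encConstraint c

theorem encItem_shape {n : ℕ} (x : CSPTerm Γ n ⊕ CSPConstraint Δ n) :
    ∃ a t, encItem x = a :: t ∧ IsHead a ∧ ∀ b ∈ t, ¬ IsHead b := by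
  cases x with
  | inl t =>
    refine ⟨_, _, rfl, Or.inl ⟨_, rfl⟩, ?_⟩
    intro b hb
    simp only [List.mem_append, List.mem_cons] at hb
    rcases hb with hb | rfl | hb | hb
    · exact not_isHead_of_mem_encNat _ b hb
    · simp [IsHead]
    · exact not_isHead_of_mem_encNat _ b hb
    · exact not_isHead_of_mem_encArgs _ b hb
  | inr c => exact ⟨_, _, rfl, Or.inr ⟨_, rfl⟩, not_isHead_of_mem_encArgs _⟩

theorem encItem_injective {n : ℕ} :
    Function.Injective (encItem : CSPTerm Γ n ⊕ CSPConstraint Δ n → List (CSPSym Γ Δ)) := by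
  rintro (t | c) (t' | c') h
  · exact congrArg _ (encTerm_injective h)
  · simp [encItem, encTerm, encConstraint] at h
  · simp [encItem, encTerm, encConstraint] at h
  · exact congrArg _ (encConstraint_injective h)

theorem enc_eq (I : CSPInst Γ Δ) :
    enc I = List.replicate I.numVars CSPSym.tick ++
      (I.terms.map Sum.inl ++ I.constraints.map Sum.inr).flatMap encItem := by
  simp [enc, List.flatMap_append, List.flatMap_map, encItem]

theorem enc_injective : Function.Injective (enc : CSPInst Γ Δ → List (CSPSym Γ Δ)) := by
  have hd : ∀ {n : ℕ} (l : List (CSPTerm Γ n ⊕ CSPConstraint Δ n)),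
      ∀ a ∈ (l.flatMap encItem).head?, IsHead a := by
    intro n l a ha
    cases l with
    | nil => simp at ha
    | cons x l =>
      obtain ⟨b, t, hb, hp, -⟩ := encItem_shape x
      simp only [List.flatMap_cons, hb, List.cons_append, List.head?_cons, Option.mem_def,
        Option.some.injEq] at ha
      exact ha ▸ hp
  have ht : ∀ n : ℕ, ∀ a ∈ List.replicate n (CSPSym.tick : CSPSym Γ Δ), ¬ IsHead a := by
    intro n a ha
    rw [List.eq_of_mem_replicate ha]
    simp [IsHead]
  rintro ⟨n, T, C⟩ ⟨n', T', C'⟩ h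
  rw [enc_eq, enc_eq] at h
  obtain ⟨h1, h⟩ := split_unique IsHead (ht _) (ht _) (hd _) (hd _) h
  have hn : n = n' := by simpa using congrArg List.length h1
  subst hn
  have h2 := flatMap_unique IsHead encItem encItem_shape encItem_injective h
  have hT : T = T' := by
    simpa [List.filterMap_append, List.filterMap_map, Function.comp_def] using
      congrArg (List.filterMap Sum.getLeft?) h2
  have hC : C = C' := by
    simpa [List.filterMap_append, List.filterMap_map, Function.comp_def] using
      congrArg (List.filterMap Sum.getRight?) h2
  rw [hT, hC]

end CSPInst

/-- The problem Min CSP(Γ, Δ). An assignment is written as the word of its values. -/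
def MinCSPWith {D : Type} (Γ : Set (CostFn D)) (Δ : Set (FinRel D)) : MinProblem where
  Inst := CSPInst Γ Δ
  Cand I := Fin I.numVars → D
  IsSol := CSPInst.IsSol
  measure := CSPInst.measure
  InstSym := CSPSym Γ Δ
  SolSym := D
  encInst := CSPInst.enc
  encCand _ σ := List.ofFn σ
  encInst_injective := CSPInst.enc_injective
  encCand_injective _ := List.ofFn_injective

/-- The problem Min CSP(Γ): no constraint applications. -/
def MinCSP {D : Type} (Γ : Set (CostFn D)) : MinProblem := MinCSPWith Γ ∅

/-!
Represent each element `e` of `D` by a new variable, and add terms of weight `2 ^ |I|`, which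
exceeds the measure of every assignment of the instance `I`, saying that the values of the new
variables form an endomorphism of `Γ`. For each constraint application `x = d`, add terms saying the
same of the new variables with `x` in place of the variable of `d`. If `I` has a solution, an
optimal assignment of the new instance violates none of these terms. As `Γ` is a core, the
endomorphism and its modification at `d` are both injective, hence permutations of the finite set
`D`; they agree away from `d`, so they agree at `d` too, and `x` has the value of the variable of
`d`. The functions in `Γ` are invariant under an injective endomorphism, so its inverse takes the
values of the old variables to an optimal solution of `I`.

The Turing machines are compiled from structured programs with a time bound. A scan of the notation
of an instance from its end meets the variable of a constraint application before its relation, so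
the unary number of the variable is known when the relation is reached.
-/

open Function

/-- Structured programs acting on stacks with alphabets `Γ` and on a register with values in `σ`,
from which Turing machines are compiled. `case` selects a program by the register and `pop` by the
letter popped; `forEach` does the latter repeatedly, until the stack is empty. -/
inductive StackProg {K : Type} (Γ : K → Type) (σ : Type) : Type
  | push (k : K) (a : Γ k)
  | load (f : σ → σ)
  | seq (p q : StackProg Γ σ)
  | case (p : σ → StackProg Γ σ)
  | pop (k : K) (p : Option (Γ k) → StackProg Γ σ)
  | forEach (k : K) (p : Γ k → StackProg Γ σ)

namespace StackProg

variable {K : Type} {Γ : K → Type} {σ : Type}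

/-- The labels of the machine that runs a program; `none` is the label of the branching statement
of a compound program. -/
def Label : StackProg Γ σ → Type
  | push _ _ => Unit
  | load _ => Unit
  | seq p q => p.Label ⊕ q.Label
  | case p => Option (Σ v, (p v).Label)
  | pop _ p => Option (Σ a, (p a).Label)
  | forEach _ p => Option (Σ a, (p a).Label)

/-- The label at which a program starts. -/
def entry : (p : StackProg Γ σ) → p.Label
  | push _ _ => ()
  | load _ => ()
  | seq p _ => Sum.inl p.entry
  | case _ => none
  | pop _ _ => none
  | forEach _ _ => none

theorem finite_label [Finite σ] [∀ k, Finite (Γ k)] (p : StackProg Γ σ) : Finite p.Label := by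
  induction p with
  | push | load => exact inferInstanceAs (Finite Unit)
  | seq p q ihp ihq => exact inferInstanceAs (Finite (p.Label ⊕ q.Label))
  | case p ih => exact inferInstanceAs (Finite (Option (Σ v, (p v).Label)))
  | pop k p ih => exact inferInstanceAs (Finite (Option (Σ a, (p a).Label)))
  | forEach k p ih => exact inferInstanceAs (Finite (Option (Σ a, (p a).Label)))

variable [DecidableEq K]

/-- The letter of the stack `k` held in the machine register, if there is one. -/
def heldLetter (k : K) (s : Option (Σ k, Γ k)) : Option (Γ k) :=
  s.bind fun a => if h : a.1 = k then some (h ▸ a.2) else none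

theorem heldLetter_map_mk (k : K) (a : Option (Γ k)) :
    heldLetter k (a.map (Sigma.mk k)) = a := by
  cases a <;> simp [heldLetter]

/-- The statement executed at each label; `e` places the labels of the program among all labels,
and `x` is the label at which to continue afterwards. The register of the machine is extended by
the letter popped last, since a `TM2` machine can branch on its register only. -/
def code {Λ : Type} : (p : StackProg Γ σ) → (p.Label → Λ) → Λ → p.Label →
    Turing.TM2.Stmt Γ Λ (σ × Option (Σ k, Γ k))
  | push k a, _, x, _ => .push k (fun _ => a) (.goto fun _ => x)
  | load f, _, x, _ => .load (fun v => (f v.1, v.2)) (.goto fun _ => x)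
  | seq p q, e, _, .inl l => p.code (fun l => e (.inl l)) (e (.inr q.entry)) l
  | seq _ q, e, x, .inr l => q.code (fun l => e (.inr l)) x l
  | case p, e, _, none => .goto fun v => e (some ⟨v.1, (p v.1).entry⟩)
  | case p, e, x, some ⟨v, l⟩ => (p v).code (fun l => e (some ⟨v, l⟩)) x l
  | pop k p, e, _, none => .pop k (fun v a => (v.1, a.map (Sigma.mk k)))
      (.goto fun v => e (some ⟨heldLetter k v.2, (p (heldLetter k v.2)).entry⟩))
  | pop _ p, e, x, some ⟨a, l⟩ => (p a).code (fun l => e (some ⟨a, l⟩)) x l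
  | forEach k p, e, x, none => .pop k (fun v a => (v.1, a.map (Sigma.mk k)))
      (.goto fun v => (heldLetter k v.2).elim x fun a => e (some ⟨a, (p a).entry⟩))
  | forEach _ p, e, _, some ⟨a, l⟩ => (p a).code (fun l => e (some ⟨a, l⟩)) (e none) l

/-- `Run p v S t v' S'`: started with register `v` and stacks `S`, the program `p` ends with
register `v'` and stacks `S'` after at most `t` steps. -/
inductive Run : StackProg Γ σ → σ → (∀ k, List (Γ k)) → ℕ → σ → (∀ k, List (Γ k)) → Prop
  | push {k a v S} : Run (push k a) v S 1 v (update S k (a :: S k))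
  | load {f v S} : Run (load f) v S 1 (f v) S
  | seq {p q v S t v' S' t' v'' S''} : Run p v S t v' S' → Run q v' S' t' v'' S'' →
      Run (seq p q) v S (t + t') v'' S''
  | case {p v S t v' S'} : Run (p v) v S t v' S' → Run (case p) v S (t + 1) v' S'
  | pop {k p v S t v' S'} : Run (p (S k).head?) v (update S k (S k).tail) t v' S' →
      Run (pop k p) v S (t + 1) v' S'
  | forEach_nil {k p v S} : S k = [] → Run (forEach k p) v S 1 v S
  | forEach_cons {k p v S a l t v' S' t' v'' S''} : S k = a :: l →
      Run (p a) v (update S k l) t v' S' → Run (forEach k p) v' S' t' v'' S'' →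
      Run (forEach k p) v S (t + t' + 1) v'' S''
  | mono {p v S t v' S' t'} : Run p v S t v' S' → t ≤ t' → Run p v S t' v' S'

section Compile

open StateTransition Turing

theorem evalsToInTime_of_step {X : Type} {f : X → Option X} {a b : X} {c : Option X} {t : ℕ}
    (h : f a = some b) (hb : Nonempty (EvalsToInTime f b c t)) :
    Nonempty (EvalsToInTime f a c (t + 1)) :=
  hb.map fun hb => EvalsToInTime.trans f 1 t a b c ⟨⟨1, h⟩, le_rfl⟩ hb

theorem evalsToInTime_trans {X : Type} {f : X → Option X} {a b : X} {c : Option X} {t t' : ℕ}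
    (h : Nonempty (EvalsToInTime f a (some b) t)) (h' : Nonempty (EvalsToInTime f b c t')) :
    Nonempty (EvalsToInTime f a c (t + t')) := by
  rw [add_comm]
  exact h.elim fun h => h'.map fun h' => EvalsToInTime.trans f t t' a b c h h'

theorem step_eq_of_code {X Λ : Type} {M : Λ → TM2.Stmt Γ Λ X} {l : Λ} {q : TM2.Stmt Γ Λ X}
    (h : M l = q) (v : X) (S : ∀ k, List (Γ k)) :
    TM2.step M ⟨some l, v, S⟩ = some (TM2.stepAux q v S) := by
  rw [TM2.step, h]

theorem Run.evalsToInTime {Λ : Type} {p : StackProg Γ σ} {v S t v' S'} (h : Run p v S t v' S')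
    (M : Λ → TM2.Stmt Γ Λ (σ × Option (Σ k, Γ k))) (e : p.Label → Λ) (x : Λ)
    (hM : ∀ l, M (e l) = p.code e x l) (j : Option (Σ k, Γ k)) :
    ∃ j', Nonempty (EvalsToInTime (TM2.step M) ⟨some (e p.entry), (v, j), S⟩
      (some ⟨some x, (v', j'), S'⟩) t) := by
  induction h generalizing x j with
  | push | load => exact ⟨j, evalsToInTime_of_step (step_eq_of_code (hM ()) _ _) ⟨.refl _ _⟩⟩
  | @seq p q _ _ _ _ _ _ _ _ _ _ ih₁ ih₂ =>
    obtain ⟨j₁, h₁⟩ := ih₁ (fun l => e (.inl l)) (e (.inr q.entry)) (fun l => hM (.inl l)) j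
    obtain ⟨j₂, h₂⟩ := ih₂ (fun l => e (.inr l)) x (fun l => hM (.inr l)) j₁
    exact ⟨j₂, evalsToInTime_trans h₁ h₂⟩
  | @case p v _ _ _ _ _ ih =>
    obtain ⟨j₁, h₁⟩ := ih (fun l => e (some ⟨v, l⟩)) x (fun l => hM (some ⟨v, l⟩)) j
    exact ⟨j₁, evalsToInTime_of_step (step_eq_of_code (hM none) _ _) h₁⟩
  | @pop k p v S _ _ _ _ ih =>
    obtain ⟨j₁, h₁⟩ := ih (fun l => e (some ⟨_, l⟩)) x (fun l => hM (some ⟨_, l⟩))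
      ((S k).head?.map (Sigma.mk k))
    refine ⟨j₁, evalsToInTime_of_step ((step_eq_of_code (hM none) _ _).trans ?_) h₁⟩
    exact congrArg (fun a => some (TM2.Cfg.mk (some (e (some ⟨a, (p a).entry⟩)))
      (v, (S k).head?.map (Sigma.mk k)) (update S k (S k).tail))) (heldLetter_map_mk k _)
  | @forEach_nil k p v S hS =>
    have hupdate : update S k [] = S := by rw [← hS, update_eq_self]
    refine ⟨none, evalsToInTime_of_step ((step_eq_of_code (hM none) _ _).trans ?_) ⟨.refl _ _⟩⟩
    simp [code, hS, heldLetter, hupdate]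
  | @forEach_cons k p v S a l _ _ _ _ _ _ hS _ _ ih₁ ih₂ =>
    obtain ⟨j₁, h₁⟩ := ih₁ (fun l => e (some ⟨a, l⟩)) (e none) (fun l => hM (some ⟨a, l⟩))
      (some ⟨k, a⟩)
    obtain ⟨j₂, h₂⟩ := ih₂ e x hM j₁
    refine ⟨j₂, evalsToInTime_of_step ((step_eq_of_code (hM none) _ _).trans ?_)
      (evalsToInTime_trans h₁ h₂)⟩
    simp [code, hS, heldLetter]
  | mono _ hle ih =>
    obtain ⟨j₁, ⟨h₁⟩⟩ := ih e x hM j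
    exact ⟨j₁, ⟨⟨h₁.toEvalsTo, h₁.steps_le_m.trans hle⟩⟩⟩

theorem initList_eq_update (tm : FinTM2) (s : List (tm.Γ tm.k₀)) :
    initList tm s = ⟨some tm.main, tm.initialState, update (fun _ => []) tm.k₀ s⟩ := by
  unfold initList
  congr 1
  funext k
  by_cases hk : k = tm.k₀
  · subst hk
    simp
  · simp [hk]

theorem haltList_eq_update (tm : FinTM2) (s : List (tm.Γ tm.k₁)) :
    haltList tm s = ⟨none, tm.initialState, update (fun _ => []) tm.k₁ s⟩ := by
  unfold haltList
  congr 1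
  funext k
  by_cases hk : k = tm.k₁
  · subst hk
    simp
  · simp [hk]

theorem tm2OutputsInTime_eq (tm : FinTM2) (s : List (tm.Γ tm.k₀)) (s' : List (tm.Γ tm.k₁))
    (t : ℕ) :
    TM2OutputsInTime tm s (some s') t = EvalsToInTime tm.step
      ⟨some tm.main, tm.initialState, update (fun _ => []) tm.k₀ s⟩
      (some ⟨none, tm.initialState, update (fun _ => []) tm.k₁ s'⟩) t := by
  rw [← initList_eq_update, ← haltList_eq_update]
  rfl

variable [Finite K] [Finite σ] [∀ k, Finite (Γ k)]

/-- The machine that runs the program `p`, forgets the letter popped last, and halts. -/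
noncomputable def toFinTM2 (p : StackProg Γ σ) (k₀ k₁ : K) (v₀ : σ) : FinTM2 where
  K := K
  kFin := Fintype.ofFinite K
  k₀ := k₀
  k₁ := k₁
  Γ := Γ
  Λ := Option p.Label
  main := some p.entry
  ΛFin := by
    have := p.finite_label
    exact Fintype.ofFinite _
  σ := σ × Option (Σ k, Γ k)
  initialState := (v₀, none)
  σFin := Fintype.ofFinite _
  Γk₀Fin := Fintype.ofFinite _
  m
    | none => .load (fun v => (v.1, none)) .halt
    | some l => p.code some none l

theorem Run.outputsInTime {p : StackProg Γ σ} {k₀ k₁ : K} {v₀ : σ} {s : List (Γ k₀)}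
    {s' : List (Γ k₁)} {t : ℕ}
    (h : Run p v₀ (update (fun _ => []) k₀ s) t v₀ (update (fun _ => []) k₁ s')) :
    Nonempty (TM2OutputsInTime (p.toFinTM2 k₀ k₁ v₀) s (some s') (t + 1)) := by
  obtain ⟨j, hrun⟩ := h.evalsToInTime (p.toFinTM2 k₀ k₁ v₀).m some none (fun _ => rfl) none
  have hhalt := evalsToInTime_of_step (step_eq_of_code (M := (p.toFinTM2 k₀ k₁ v₀).m)
    (l := none) rfl (v₀, j) (update (fun _ => []) k₁ s')) ⟨.refl _ _⟩
  have hoverall := evalsToInTime_trans hrun hhalt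
  exact (congrArg Nonempty (tm2OutputsInTime_eq (p.toFinTM2 k₀ k₁ v₀) s s' _)).mpr hoverall

theorem polyTimeComputable {α β : Type} {k₀ k₁ : K} {ea : α → List (Γ k₀)}
    {eb : β → List (Γ k₁)} {f : α → β} (p : StackProg Γ σ) (v₀ : σ) (c d : ℕ)
    (h : ∀ a, Run p v₀ (update (fun _ => []) k₀ (ea a)) (c * ((ea a).length + 1) ^ d) v₀
      (update (fun _ => []) k₁ (eb (f a)))) :
    PolyTimeComputable ea eb f := by
  refine ⟨⟨⟨p.toFinTM2 k₀ k₁ v₀, Equiv.refl _, Equiv.refl _⟩,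
    Polynomial.C c * (Polynomial.X + 1) ^ d + 1, fun a => Classical.choice ?_⟩⟩
  have htime : (Polynomial.C c * (Polynomial.X + 1) ^ d + 1 : Polynomial ℕ).eval (ea a).length =
      c * ((ea a).length + 1) ^ d + 1 := by simp
  rw [htime]
  exact (congrArg₂ (fun s s' => Nonempty (TM2OutputsInTime (p.toFinTM2 k₀ k₁ v₀) s (some s') _))
    (List.map_id (ea a)) (List.map_id (eb (f a)))).mpr (h a).outputsInTime

end Compile

/-- The program that does nothing. -/
def skip : StackProg Γ σ := load id

theorem Run.skip {v : σ} {S : ∀ k, List (Γ k)} : Run skip v S 1 v S := Run.load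

theorem Run.congr {p : StackProg Γ σ} {v S t v' S' t' v'' S''} (h : Run p v S t v' S')
    (ht : t ≤ t') (hv : v' = v'') (hS : S' = S'') : Run p v S t' v'' S'' := by
  subst hv hS
  exact h.mono ht

/-- A loop computes a fold over the word on its stack: `reg` and `stk` are the register and the
stacks when the word `l` is left and `x` has been accumulated. -/
theorem Run.forEach {X : Type} {k : K} {p : Γ k → StackProg Γ σ} {f : X → Γ k → X} {reg : X → σ}
    {stk : List (Γ k) → X → ∀ k, List (Γ k)} {P : List (Γ k) → X → Prop} {c : ℕ}
    (hstk : ∀ l l' x, update (stk l x) k l' = stk l' x)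
    (hP : ∀ a l x, P (a :: l) x → P l (f x a))
    (hbody : ∀ a l x, P (a :: l) x →
      Run (p a) (reg x) (stk l x) c (reg (f x a)) (stk l (f x a)))
    (l : List (Γ k)) {x : X} (hx : P l x) :
    Run (forEach k p) (reg x) (stk l x) ((c + 1) * l.length + 1)
      (reg (l.foldl f x)) (stk [] (l.foldl f x)) := by
  have hword : ∀ l x, stk l x k = l := fun l x => by rw [← hstk l l x, update_self]
  induction l generalizing x with
  | nil => exact (Run.forEach_nil (hword _ _)).mono (by simp)
  | cons a l ih =>
    have hrun := hbody a l x hx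
    rw [← hstk (a :: l)] at hrun
    exact (Run.forEach_cons (hword _ _) hrun (ih (hP a l x hx))).mono
      (by rw [List.length_cons]; linarith)

/-- Run the programs of the letters of a word, last letter first, so that a program pushing the
images of the letters leaves the image of the first letter on top. -/
def pushEach {A : Type} (p : A → StackProg Γ σ) (l : List A) : StackProg Γ σ :=
  l.foldr (fun a q => seq q (p a)) skip

theorem Run.pushEach {A B : Type} {p : A → StackProg Γ σ} {e : A → List B} {v : σ}
    {stk : List B → ∀ k, List (Γ k)} {c : ℕ}
    (hp : ∀ a b, Run (p a) v (stk b) c v (stk (e a ++ b))) (l : List A) (b : List B) :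
    Run (pushEach p l) v (stk b) (c * l.length + 1) v (stk (l.flatMap e ++ b)) := by
  induction l with
  | nil => exact Run.skip.mono (by simp)
  | cons a l ih =>
    exact (ih.seq (hp a _)).congr (by rw [List.length_cons]; linarith) rfl
      (by rw [List.flatMap_cons, List.append_assoc])

/-- Push a word, its first letter ending up on top. -/
def pushWord (k : K) (l : List (Γ k)) : StackProg Γ σ := pushEach (push k) l

theorem Run.pushWord (k : K) (l : List (Γ k)) (v : σ) (S : ∀ k, List (Γ k)) :
    Run (pushWord k l) v S (l.length + 1) v (update S k (l ++ S k)) := by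
  have hpush : ∀ a b, Run (.push k a) v (update S k b) 1 v (update S k ([a] ++ b)) :=
    fun a b => Run.push.congr le_rfl rfl (by simp)
  exact (update_eq_self k S ▸ Run.pushEach hpush l (S k)).congr (by simp) rfl (by simp)

/-- Apply to the register a function of the letter on top of the stack `k`. -/
def peek (k : K) (f : Option (Γ k) → σ → σ) : StackProg Γ σ :=
  pop k fun a => seq (pushWord k a.toList) (load (f a))

theorem Run.peek (k : K) (f : Option (Γ k) → σ → σ) (v : σ) (S : ∀ k, List (Γ k)) :
    Run (peek k f) v S 4 (f (S k).head? v) S := by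
  refine (Run.pop ((Run.pushWord k _ v _).seq .load)).congr ?_ rfl ?_
  · cases S k <;> simp
  · rw [update_self, update_idem]
    have hword : (S k).head?.toList ++ (S k).tail = S k := by cases S k <;> rfl
    rw [hword, update_eq_self]

/-- Empty the stack `k`. -/
def clear (k : K) : StackProg Γ σ := forEach k fun _ => skip

theorem Run.clear (k : K) (v : σ) (S : ∀ k, List (Γ k)) :
    Run (clear k) v S (2 * (S k).length + 1) v (update S k []) := by
  have hrun := Run.forEach (p := fun _ => StackProg.skip) (f := fun (_ : Unit) _ => ())
    (reg := fun _ => v) (stk := fun l _ => update S k l) (P := fun _ _ => True)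
    (fun _ _ _ => update_idem _ _ _) (fun _ _ _ _ => trivial) (fun _ _ _ _ => Run.skip)
    (S k) (x := ()) trivial
  rwa [update_eq_self] at hrun

/-- Move the letters of the stack `k`, changed by `f`, to the stack `k'`. -/
def move (k k' : K) (f : Γ k → Γ k') : StackProg Γ σ := forEach k fun a => push k' (f a)

theorem Run.move {k k' : K} (hk : k ≠ k') (f : Γ k → Γ k') (v : σ) (S : ∀ k, List (Γ k)) :
    Run (move k k' f) v S (2 * (S k).length + 1) v
      (update (update S k []) k' (((S k).map f).reverse ++ S k')) := by
  have hrun := Run.forEach (p := fun a => StackProg.push k' (f a)) (f := fun u a => f a :: u)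
    (reg := fun _ => v) (stk := fun l u => update (update S k l) k' u) (P := fun _ _ => True)
    (fun l l' u => by rw [update_comm hk.symm, update_idem])
    (fun _ _ _ _ => trivial)
    (fun a l u _ => Run.push.congr le_rfl rfl (by simp)) (S k) (x := S k') trivial
  rwa [update_eq_self, update_eq_self, List.foldl_flip_cons_eq_append] at hrun

/-- Push on `out` one letter `a` for each letter of the stack `k`, using the empty stack `tmp`;
`f` and `f'` translate the letters of `k` into letters of `tmp` and back. -/
def pushCopies (k tmp out : K) (f : Γ k → Γ tmp) (f' : Γ tmp → Γ k) (a : Γ out) :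
    StackProg Γ σ :=
  seq (forEach k fun b => seq (push tmp (f b)) (push out a)) (move tmp k f')

theorem Run.pushCopies {k tmp out : K} (htmp : k ≠ tmp) (hout : k ≠ out) (hne : tmp ≠ out)
    {f : Γ k → Γ tmp} {f' : Γ tmp → Γ k} (hf : LeftInverse f' f) (a : Γ out) (v : σ)
    {S : ∀ k, List (Γ k)} (hS : S tmp = []) :
    Run (pushCopies k tmp out f f' a) v S (5 * (S k).length + 2) v
      (update S out (List.replicate (S k).length a ++ S out)) := by
  let stk (l u : List (Γ k)) : ∀ k, List (Γ k) :=
    update (update (update S k l) tmp (u.map f)) out (List.replicate u.length a ++ S out)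
  have hbody : ∀ b l u, True → Run (.seq (.push tmp (f b)) (.push out a)) v (stk l u) 2 v
      (stk l (b :: u)) := by
    intro b l u _
    refine (Run.push.seq .push).congr le_rfl rfl ?_
    simp [stk, hne, update_comm hne.symm, List.replicate_succ]
  have hcopy := Run.forEach (f := fun u b => b :: u) (reg := fun _ => v) (stk := stk)
    (P := fun _ _ => True)
    (fun l l' u => by
      simp only [stk, update_comm hout.symm, update_comm htmp.symm, update_idem])
    (fun _ _ _ _ => trivial) hbody (S k) (x := []) trivial
  have hstart : stk (S k) [] = S := by simp [stk, ← hS]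
  rw [hstart, List.foldl_flip_cons_eq_append', List.append_nil] at hcopy
  refine (hcopy.seq (.move htmp.symm f' v _)).congr ?_ rfl ?_
  · simp [stk, hne]
    omega
  · have hback : f' ∘ f = id := funext hf
    simp [stk, hne, htmp, hout, hback, update_comm hout.symm, update_comm htmp.symm,
      update_comm hne.symm, ← hS]

end StackProg

section Endomorphisms

variable {D : Type}

theorem isEndo_id (h : CostFn D) : IsEndo h id := fun _ hx => hx

/- Composition with `g` is an injective self-map of the finite set of zeros of `h`, hence a
surjective one. -/
theorem IsEndo.apply_comp [Finite D] {h : CostFn D} {g : D → D} (hg : IsEndo h g)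
    (hinj : Injective g) (x : Fin h.1 → D) : h.2 (g ∘ x) = h.2 x := by
  have hzero : h.2 (g ∘ x) = 0 ↔ h.2 x = 0 := by
    refine ⟨fun hgx => ?_, hg x⟩
    have hbij := ((Set.toFinite {x | h.2 x = 0}).injOn_iff_bijOn_of_mapsTo
      (f := (g ∘ ·)) hg).1 hinj.comp_left.injOn
    obtain ⟨y, hy, hgy⟩ := hbij.surjOn hgx
    exact hinj.comp_left hgy ▸ hy
  omega

theorem eq_apply_of_injective_update {α : Type*} [Finite α] [DecidableEq α] {g : α → α} {a b : α}
    (hg : Injective g) (hupdate : Injective (update g a b)) : b = g a := by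
  obtain ⟨c, rfl⟩ := Finite.surjective_of_injective hg b
  by_contra hne
  have hca : c ≠ a := fun h => hne (h ▸ rfl)
  exact hca (hupdate (by rw [update_self, update_of_ne hca]))

end Endomorphisms

section Values

variable {D : Type} {Γ : Set (CostFn D)} {Δ : Set (FinRel D)} {m n : ℕ}

namespace CSPTerm

/-- The value of a weighted term at an assignment. -/
def value (t : CSPTerm Γ n) (σ : Fin n → D) : ℚ≥0 :=
  t.weight * ((t.fn.1.2 (σ ∘ t.args)).val : ℚ≥0)

/-- Replace the variables of a term. -/
def rename (ν : Fin n → Fin m) (t : CSPTerm Γ n) : CSPTerm Γ m := ⟨t.weight, t.fn, ν ∘ t.args⟩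

theorem value_eq_zero_iff {t : CSPTerm Γ n} {σ : Fin n → D} (hw : t.weight ≠ 0) :
    t.value σ = 0 ↔ t.fn.1.2 (σ ∘ t.args) = 0 := by
  rw [value, mul_eq_zero, or_iff_right hw, Nat.cast_eq_zero, Fin.val_eq_zero_iff]

theorem value_le_weight (t : CSPTerm Γ n) (σ : Fin n → D) : t.value σ ≤ t.weight :=
  mul_le_of_le_one_right zero_le (by exact_mod_cast Fin.is_le _)

theorem value_eq_zero_of_lt {t : CSPTerm Γ n} {σ : Fin n → D} (h : t.value σ < t.weight) :
    t.value σ = 0 := by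
  rw [value_eq_zero_iff (zero_le.trans_lt h).ne']
  by_contra hne
  have hone : t.fn.1.2 (σ ∘ t.args) = 1 := by omega
  simp [value, hone] at h

theorem value_comp [Finite D] {t : CSPTerm Γ n} {g : D → D} (hg : IsEndo t.fn.1 g)
    (hinj : Injective g) (σ : Fin n → D) : t.value (g ∘ σ) = t.value σ := by
  rw [value, comp_assoc, hg.apply_comp hinj, value]

theorem weight_add_one_le (t : CSPTerm Γ n) :
    t.weight + 1 ≤ 2 ^ (CSPInst.encTerm (Δ := Δ) t).length := by
  have hnum : t.weight ≤ t.weight.num := by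
    conv_lhs => rw [← NNRat.num_div_den t.weight]
    exact div_le_self zero_le (by exact_mod_cast t.weight.den_pos)
  have hsize : t.weight.num + 1 ≤ 2 ^ t.weight.num.bits.length := by
    rw [Nat.size_eq_bits_len]
    exact Nat.lt_size_self _
  calc t.weight + 1 ≤ (t.weight.num : ℚ≥0) + 1 := by gcongr
    _ ≤ 2 ^ t.weight.num.bits.length := by exact_mod_cast hsize
    _ ≤ _ := pow_le_pow_right₀ one_le_two (by
        simp only [CSPInst.encTerm, CSPInst.encNat, List.length_cons, List.length_append,
          List.length_map]
        omega)

end CSPTerm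

namespace CSPInst

theorem measure_eq_sum_value (I : CSPInst Γ Δ) (σ : Fin I.numVars → D) :
    I.measure σ = (I.terms.map (·.value σ)).sum := rfl

theorem value_le_measure {I : CSPInst Γ Δ} {t : CSPTerm Γ I.numVars} (ht : t ∈ I.terms)
    (σ : Fin I.numVars → D) : t.value σ ≤ I.measure σ :=
  List.single_le_sum (fun _ _ => zero_le) _ (List.mem_map_of_mem (f := (·.value σ)) ht)

theorem measure_comp [Finite D] {g : D → D} (hg : ∀ h ∈ Γ, IsEndo h g) (hinj : Injective g)
    (I : CSPInst Γ Δ) (σ : Fin I.numVars → D) : I.measure (g ∘ σ) = I.measure σ := by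
  simp only [measure_eq_sum_value, CSPTerm.value_comp (hg _ (Subtype.prop _)) hinj]

theorem sum_value_add_one_le (l : List (CSPTerm Γ n)) (σ : Fin n → D) :
    (l.map (·.value σ)).sum + 1 ≤ 2 ^ (l.flatMap (encTerm (Δ := Δ))).length := by
  induction l with
  | nil => simp
  | cons t l ih =>
    rw [List.map_cons, List.sum_cons, List.flatMap_cons, List.length_append, pow_add]
    calc t.value σ + (l.map (·.value σ)).sum + 1
        ≤ (t.value σ + 1) * ((l.map (·.value σ)).sum + 1) := by
          rw [add_one_mul, mul_add_one, add_assoc, add_assoc]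
          exact le_add_self
      _ ≤ _ := mul_le_mul' ((add_le_add_left (t.value_le_weight σ) 1).trans t.weight_add_one_le) ih

theorem measure_lt_two_pow (I : CSPInst Γ Δ) (σ : Fin I.numVars → D) :
    I.measure σ < 2 ^ I.enc.length := by
  refine (lt_add_one _).trans_le ((sum_value_add_one_le (Δ := Δ) I.terms σ).trans
    (pow_le_pow_right₀ one_le_two ?_))
  simp only [enc, List.length_append]
  omega

end CSPInst

end Values

section ConstantRelations

variable {D : Type}

theorem constRel_injective :
    Injective fun d : D => (⟨1, {x | x 0 = d}⟩ : FinRel D) := by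
  intro d e h
  have hset : {x : Fin 1 → D | x 0 = d} = {x | x 0 = e} := eq_of_heq (Sigma.mk.inj h).2
  exact (Set.ext_iff.1 hset fun _ => d).1 rfl

/-- The correspondence between elements of the domain and constant relations. -/
noncomputable def constEquiv : D ≃ constRels D := Equiv.ofInjective _ constRel_injective

instance [Finite D] : Finite (constRels D) := Finite.of_equiv D constEquiv

theorem arity_eq_one (R : constRels D) : R.1.1 = 1 := by
  obtain ⟨_, d, rfl⟩ := R
  rfl

/-- The constant `d` of the constant relation `{d}`. -/
noncomputable def constOf (R : constRels D) : D := constEquiv.symm R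

namespace CSPConstraint

variable {n : ℕ}

/-- The variable to which a constant relation is applied. -/
def constVar (c : CSPConstraint (constRels D) n) : Fin n :=
  c.args ⟨0, (arity_eq_one c.rel).symm ▸ Nat.one_pos⟩

theorem mem_rel_iff (c : CSPConstraint (constRels D) n) (σ : Fin n → D) :
    (fun i => σ (c.args i)) ∈ c.rel.1.2 ↔ σ c.constVar = constOf c.rel := by
  obtain ⟨⟨_, d, rfl⟩, args⟩ := c
  have hconst : constOf ⟨_, d, rfl⟩ = d := constEquiv.symm_apply_apply d
  rw [hconst]
  rfl

theorem encConstraint_eq {Γ : Set (CostFn D)} (c : CSPConstraint (constRels D) n) :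
    (CSPInst.encConstraint c : List (CSPSym Γ (constRels D))) =
      .rel c.rel :: .sep :: List.replicate c.constVar .tick := by
  obtain ⟨⟨_, d, rfl⟩, args⟩ := c
  have hargs : List.ofFn args = [args 0] := List.ofFn_succ
  simp only [CSPInst.encConstraint, CSPInst.encArgs, hargs, List.flatMap_singleton]
  rfl

end CSPConstraint

theorem CSPInst.isSol_iff {Γ : Set (CostFn D)} {I : CSPInst Γ (constRels D)}
    {σ : Fin I.numVars → D} :
    I.IsSol σ ↔ ∀ c ∈ I.constraints, σ c.constVar = constOf c.rel :=
  forall₂_congr fun c _ => c.mem_rel_iff σ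

noncomputable instance CSPInst.decidableIsSol [DecidableEq D] {Γ : Set (CostFn D)}
    (I : CSPInst Γ (constRels D)) (σ : Fin I.numVars → D) : Decidable (I.IsSol σ) :=
  decidable_of_iff _ CSPInst.isSol_iff.symm

end ConstantRelations

namespace ConstReduction

variable {D : Type} [Finite D] {Γ : Set (CostFn D)} {m n : ℕ}

section Gadgets

variable [Finite Γ]

variable (Γ) in
/-- All pairs of a function in `Γ` and a tuple at which it vanishes. -/
noncomputable def zeros : List (Σ f : Γ, Fin f.1.1 → D) :=
  (Set.toFinite {p : Σ f : Γ, Fin f.1.1 → D | p.1.1.2 p.2 = 0}).toFinset.toList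

theorem mem_zeros {p : Σ f : Γ, Fin f.1.1 → D} : p ∈ zeros Γ ↔ p.1.1.2 p.2 = 0 := by
  simp [zeros]

/-- Terms which say that the map `e ↦ σ (ρ e)` is an endomorphism of `Γ`: they vanish at `σ` if and
only if it is, and otherwise contribute at least `w`. -/
noncomputable def endoGadget (w : ℚ≥0) (ρ : D → Fin m) : List (CSPTerm Γ m) :=
  (zeros Γ).map fun p => ⟨w, p.1, ρ ∘ p.2⟩

theorem weight_of_mem_endoGadget {w : ℚ≥0} {ρ : D → Fin m} {t : CSPTerm Γ m}
    (ht : t ∈ endoGadget w ρ) : t.weight = w := by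
  obtain ⟨p, -, rfl⟩ := List.mem_map.1 ht
  rfl

theorem forall_value_eq_zero_iff {w : ℚ≥0} (hw : w ≠ 0) {ρ : D → Fin m} {σ : Fin m → D} :
    (∀ t ∈ endoGadget (Γ := Γ) w ρ, t.value σ = 0) ↔ ∀ h ∈ Γ, IsEndo h (σ ∘ ρ) := by
  have hterm : ∀ p : Σ f : Γ, Fin f.1.1 → D,
      (⟨w, p.1, ρ ∘ p.2⟩ : CSPTerm Γ m).value σ = 0 ↔ p.1.1.2 ((σ ∘ ρ) ∘ p.2) = 0 :=
    fun p => CSPTerm.value_eq_zero_iff hw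
  simp only [endoGadget, List.forall_mem_map, mem_zeros, hterm]
  exact ⟨fun h f hf x => h ⟨⟨f, hf⟩, x⟩, fun h p => h p.1 p.1.2 p.2⟩

end Gadgets

/-- An enumeration of the domain. -/
noncomputable def idx : D ≃ Fin (Nat.card D) := Finite.equivFin D

/-- The new variable that represents the element `e` of the domain; the variables of the original
instance come after the new ones. -/
noncomputable def elemVar (n : ℕ) (e : D) : Fin (Nat.card D + n) := Fin.castAdd n (idx e)

/-- The assignment of the original instance obtained from one of the reduced instance: the values
are translated back by a left inverse of the endomorphism `s ∘ elemVar n`. -/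
noncomputable def pullBack (s : Fin (Nat.card D + n) → D) : Fin n → D :=
  extend (s ∘ elemVar n) id id ∘ s ∘ Fin.natAdd _

theorem comp_pullBack {s : Fin (Nat.card D + n) → D} (hs : Injective (s ∘ elemVar n)) :
    (s ∘ elemVar n) ∘ pullBack s = s ∘ Fin.natAdd _ := by
  funext i
  obtain ⟨e, he⟩ := Finite.surjective_of_injective hs (s (Fin.natAdd _ i))
  change (s ∘ elemVar n) (extend (s ∘ elemVar n) id id (s (Fin.natAdd _ i))) = _
  rw [← he, hs.extend_apply, id, he, comp_apply]

variable [DecidableEq D]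

/-- The representation of the elements of the domain in which the variable subject to the
constraint `c` takes the place of the variable of its constant. -/
noncomputable def constraintVar (c : CSPConstraint (constRels D) n) :
    D → Fin (Nat.card D + n) :=
  update (elemVar n) (constOf c.rel) (Fin.natAdd _ c.constVar)

/-- The representations of the elements of the domain by variables that are to be
endomorphisms. -/
noncomputable def representations (I : CSPInst Γ (constRels D)) :
    List (D → Fin (Nat.card D + I.numVars)) :=
  I.constraints.map constraintVar ++ [elemVar I.numVars]

theorem append_comp_of_mem_representations {I : CSPInst Γ (constRels D)} {σ : Fin I.numVars → D}
    (hσ : I.IsSol σ) {ρ : D → Fin (Nat.card D + I.numVars)} (hρ : ρ ∈ representations I) :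
    Fin.append idx.symm σ ∘ ρ = id := by
  have helem : Fin.append idx.symm σ ∘ elemVar I.numVars = id := by
    funext e
    simp [elemVar]
  rw [representations, List.mem_append, List.mem_map, List.mem_singleton] at hρ
  obtain ⟨c, hc, rfl⟩ | rfl := hρ
  · rw [constraintVar, comp_update, helem, Fin.append_right, CSPInst.isSol_iff.1 hσ c hc]
    exact update_eq_self _ id
  · exact helem

/-- The answer to the original instance obtained from a solution of the reduced instance. -/
noncomputable def recoverSol (I : CSPInst Γ (constRels D))
    (s : Fin (Nat.card D + I.numVars) → D) : Option (Fin I.numVars → D) :=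
  if I.IsSol (pullBack s) then some (pullBack s) else none

theorem recoverSol_eq_none {I : CSPInst Γ (constRels D)}
    (hunsat : ¬ (MinCSPWith Γ (constRels D)).Satisfiable I)
    (s : Fin (Nat.card D + I.numVars) → D) : recoverSol I s = none :=
  if_neg fun h => hunsat ⟨_, h⟩

variable [Finite Γ]

/-- The terms which say that all representations are endomorphisms. -/
noncomputable def gadgets (I : CSPInst Γ (constRels D)) :
    List (CSPTerm Γ (Nat.card D + I.numVars)) :=
  (representations I).flatMap (endoGadget (2 ^ I.enc.length))

/-- The instance of Min CSP(Γ) to which `I` is reduced. -/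
noncomputable def reduceInst (I : CSPInst Γ (constRels D)) : CSPInst Γ ∅ where
  numVars := Nat.card D + I.numVars
  terms := I.terms.map (CSPTerm.rename (Fin.natAdd _)) ++ gadgets I
  constraints := []

theorem isSol_reduceInst (I : CSPInst Γ (constRels D)) (s : Fin (Nat.card D + I.numVars) → D) :
    (reduceInst I).IsSol s :=
  List.forall_mem_nil _

theorem measure_reduceInst (I : CSPInst Γ (constRels D))
    (s : Fin (Nat.card D + I.numVars) → D) :
    (reduceInst I).measure s =
      I.measure (s ∘ Fin.natAdd _) + ((gadgets I).map (·.value s)).sum := by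
  simp only [CSPInst.measure_eq_sum_value, reduceInst, List.map_append, List.sum_append,
    List.map_map]
  rfl

theorem measure_append_of_isSol {I : CSPInst Γ (constRels D)} {σ : Fin I.numVars → D}
    (hσ : I.IsSol σ) : (reduceInst I).measure (Fin.append idx.symm σ) = I.measure σ := by
  have hzero : ∀ t ∈ gadgets I, t.value (Fin.append idx.symm σ) = 0 := by
    intro t ht
    obtain ⟨ρ, hρ, ht⟩ := List.mem_flatMap.1 ht
    refine (forall_value_eq_zero_iff (pow_ne_zero _ two_ne_zero)).2 (fun h _ => ?_) t ht
    rw [append_comp_of_mem_representations hσ hρ]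
    exact isEndo_id h
  have happend : Fin.append idx.symm σ ∘ Fin.natAdd _ = σ := by
    funext i
    simp
  rw [measure_reduceInst, happend, List.sum_eq_zero (by simpa using hzero), add_zero]

theorem isEndo_of_mem_representations {I : CSPInst Γ (constRels D)}
    {s : Fin (Nat.card D + I.numVars) → D} (hs : (reduceInst I).measure s < 2 ^ I.enc.length)
    {ρ : D → Fin (Nat.card D + I.numVars)} (hρ : ρ ∈ representations I) :
    ∀ h ∈ Γ, IsEndo h (s ∘ ρ) := by
  refine (forall_value_eq_zero_iff (pow_ne_zero I.enc.length two_ne_zero)).1 fun t ht => ?_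
  have hmem : t ∈ (reduceInst I).terms :=
    List.mem_append_right _ (List.mem_flatMap.2 ⟨ρ, hρ, ht⟩)
  apply CSPTerm.value_eq_zero_of_lt
  rw [weight_of_mem_endoGadget ht]
  exact (CSPInst.value_le_measure hmem s).trans_lt hs

theorem isSol_pullBack (hcore : IsCore Γ) {I : CSPInst Γ (constRels D)}
    {s : Fin (Nat.card D + I.numVars) → D} (hs : (reduceInst I).measure s < 2 ^ I.enc.length) :
    I.IsSol (pullBack s) := by
  have hinj : ∀ ρ ∈ representations I, Injective (s ∘ ρ) :=
    fun ρ hρ => hcore _ (isEndo_of_mem_representations hs hρ)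
  have helem : Injective (s ∘ elemVar I.numVars) := hinj _ (by simp [representations])
  refine CSPInst.isSol_iff.2 fun c hc => ?_
  have hconstraint := hinj (constraintVar c)
    (List.mem_append_left _ (List.mem_map_of_mem hc))
  rw [constraintVar, comp_update] at hconstraint
  have hvalue := congrFun (comp_pullBack helem) c.constVar
  exact helem (hvalue.trans (eq_apply_of_injective_update helem hconstraint))

theorem measure_pullBack_le (hcore : IsCore Γ) {I : CSPInst Γ (constRels D)}
    {s : Fin (Nat.card D + I.numVars) → D} (hs : (reduceInst I).measure s < 2 ^ I.enc.length) :
    I.measure (pullBack s) ≤ (reduceInst I).measure s := by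
  have hendo : ∀ h ∈ Γ, IsEndo h (s ∘ elemVar I.numVars) :=
    isEndo_of_mem_representations hs (by simp [representations])
  have hinj := hcore _ hendo
  rw [measure_reduceInst, ← comp_pullBack hinj, CSPInst.measure_comp hendo hinj]
  exact le_self_add

theorem isOptSol_recoverSol (hcore : IsCore Γ) {I : CSPInst Γ (constRels D)}
    {s : Fin (Nat.card D + I.numVars) → D} (hs : (MinCSP Γ).IsOptSol (reduceInst I) s)
    (hsat : (MinCSPWith Γ (constRels D)).Satisfiable I) :
    ∃ σ, recoverSol I s = some σ ∧ (MinCSPWith Γ (constRels D)).IsOptSol I σ := by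
  have hle : ∀ σ, I.IsSol σ → (reduceInst I).measure s ≤ I.measure σ := fun σ hσ =>
    (hs.2 _ (isSol_reduceInst I _)).trans_eq (measure_append_of_isSol hσ)
  obtain ⟨σ₀, hσ₀⟩ := hsat
  have hlt := (hle σ₀ hσ₀).trans_lt (I.measure_lt_two_pow σ₀)
  have hsol := isSol_pullBack hcore hlt
  exact ⟨pullBack s, if_pos hsol, hsol,
    fun σ hσ => (measure_pullBack_le hcore hlt).trans (hle σ hσ)⟩

end ConstReduction

section Scan

variable {D : Type} {Γ : Set (CostFn D)} {Δ : Set (FinRel D)}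

/-- The part of an instance to which a letter of its notation belongs; the letters that list the
variables are counted among those of a numerator. -/
inductive Phase
  | num | den | args | constr
  deriving DecidableEq

instance : Fintype Phase where
  elems := {.num, .den, .args, .constr}
  complete q := by cases q <;> simp

namespace Phase

/-- The part to which the letter `a` belongs if the letter before it belongs to the part `q`. -/
def next (q : Phase) (a : CSPSym Γ Δ) : Phase :=
  match q, a with
  | _, .fn _ => num
  | _, .rel _ => constr
  | num, .sep => den
  | den, .sep => args
  | q, _ => q

end Phase

/-- A word, each letter of which is paired with the part of the instance to which it belongs. -/
def annotate : Phase → List (CSPSym Γ Δ) → List (Phase × CSPSym Γ Δ)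
  | _, [] => []
  | q, a :: w => (q.next a, a) :: annotate (q.next a) w

theorem length_annotate (q : Phase) (w : List (CSPSym Γ Δ)) : (annotate q w).length = w.length := by
  induction w generalizing q with
  | nil => rfl
  | cons a w ih => exact congrArg (· + 1) (ih _)

theorem annotate_append (q : Phase) (w w' : List (CSPSym Γ Δ)) :
    annotate q (w ++ w') = annotate q w ++ annotate (w.foldl Phase.next q) w' := by
  induction w generalizing q with
  | nil => rfl
  | cons a w ih => exact congrArg (_ :: ·) (ih _)

theorem annotate_append_of_fixed {q : Phase} {w : List (CSPSym Γ Δ)} (h : ∀ a ∈ w, q.next a = q)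
    (w' : List (CSPSym Γ Δ)) : annotate q (w ++ w') = w.map (Prod.mk q) ++ annotate q w' := by
  induction w with
  | nil => rfl
  | cons a w ih =>
    rw [List.forall_mem_cons] at h
    rw [List.cons_append, annotate, h.1, ih h.2, List.map_cons, List.cons_append]

theorem annotate_flatMap {X : Type} {e : X → List (CSPSym Γ Δ)}
    {e' : X → List (Phase × CSPSym Γ Δ)} (h : ∀ q x, annotate q (e x) = e' x) (q : Phase)
    (l : List X) : annotate q (l.flatMap e) = l.flatMap e' := by
  induction l generalizing q with
  | nil => rfl
  | cons x l ih => rw [List.flatMap_cons, annotate_append, h, ih, List.flatMap_cons]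

theorem foldl_annotate (q : Phase) (w : List (CSPSym Γ Δ)) (u : List (Phase × CSPSym Γ Δ)) :
    w.foldl (fun s a => (s.1.next a, (s.1.next a, a) :: s.2)) (q, u) =
      (w.foldl Phase.next q, (annotate q w).reverse ++ u) := by
  induction w generalizing q u with
  | nil => rfl
  | cons a w ih => simp [annotate, ih]

/-- The annotated notation of a term. -/
def termTokens {n : ℕ} (t : CSPTerm Γ n) : List (Phase × CSPSym Γ Δ) :=
  (.num, .fn t.fn) :: ((CSPInst.encNat t.weight.num).map (Prod.mk .num) ++ (.den, .sep) ::
    ((CSPInst.encNat t.weight.den).map (Prod.mk .den) ++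
      (CSPInst.encArgs (List.ofFn t.args)).map (Prod.mk .args)))

theorem annotate_encArgs {n : ℕ} (l : List (Fin n)) {q : Phase} (hq : q = .den ∨ q = .args) :
    annotate q (CSPInst.encArgs l : List (CSPSym Γ Δ)) =
      (CSPInst.encArgs l).map (Prod.mk .args) := by
  cases l with
  | nil => rfl
  | cons v l =>
    have hfixed : ∀ a ∈ List.replicate v .tick ++ (CSPInst.encArgs l : List (CSPSym Γ Δ)),
        Phase.args.next a = .args := by
      intro a ha
      simp only [List.mem_append, List.mem_replicate, CSPInst.encArgs, List.mem_flatMap,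
        List.mem_cons] at ha
      obtain ⟨-, rfl⟩ | ⟨_, -, rfl | ⟨-, rfl⟩⟩ := ha <;> rfl
    have hsep : q.next (.sep : CSPSym Γ Δ) = .args := by obtain rfl | rfl := hq <;> rfl
    have hrest := annotate_append_of_fixed hfixed []
    rw [List.append_nil] at hrest
    simp only [CSPInst.encArgs, List.flatMap_cons, List.cons_append, annotate, hsep,
      List.map_cons] at hrest ⊢
    rw [hrest, List.append_nil]

theorem annotate_encTerm (q : Phase) {n : ℕ} (t : CSPTerm Γ n) :
    annotate q (CSPInst.encTerm t : List (CSPSym Γ Δ)) = termTokens t := by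
  have hbits : ∀ q, (q = .num ∨ q = .den) → ∀ (m : ℕ) (w : List (CSPSym Γ Δ)),
      annotate q (CSPInst.encNat m ++ w) = (CSPInst.encNat m).map (Prod.mk q) ++ annotate q w := by
    rintro q hq m w
    refine annotate_append_of_fixed (fun a ha => ?_) w
    obtain ⟨b, -, rfl⟩ := List.mem_map.1 ha
    obtain rfl | rfl := hq <;> rfl
  have hfn : q.next (.fn t.fn : CSPSym Γ Δ) = .num := by cases q <;> rfl
  rw [CSPInst.encTerm, annotate, hfn, hbits _ (.inl rfl), annotate, Phase.next,
    hbits _ (.inr rfl), annotate_encArgs _ (.inl rfl), termTokens]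

/-- The annotated notation of a constraint application. -/
def constraintTokens {n : ℕ} (c : CSPConstraint (constRels D) n) :
    List (Phase × CSPSym Γ (constRels D)) :=
  (.constr, .rel c.rel) :: (.constr, .sep) :: List.replicate c.constVar (.constr, .tick)

theorem annotate_encConstraint (q : Phase) {n : ℕ} (c : CSPConstraint (constRels D) n) :
    annotate q (CSPInst.encConstraint c : List (CSPSym Γ (constRels D))) = constraintTokens c := by
  have hticks := annotate_append_of_fixed (q := .constr)
    (w := List.replicate c.constVar (.tick : CSPSym Γ (constRels D)))
    (fun a ha => by rw [List.eq_of_mem_replicate ha]; rfl) []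
  have hrel : q.next (.rel c.rel : CSPSym Γ (constRels D)) = .constr := by cases q <;> rfl
  rw [List.append_nil, List.map_replicate, annotate, List.append_nil] at hticks
  rw [c.encConstraint_eq, annotate, hrel, annotate, Phase.next, hticks, constraintTokens] <;> simp

/-- The annotated notation of the variables and terms of an instance. -/
def sumTokens (I : CSPInst Γ (constRels D)) : List (Phase × CSPSym Γ (constRels D)) :=
  List.replicate I.numVars (.num, .tick) ++ I.terms.flatMap termTokens

theorem annotate_enc (I : CSPInst Γ (constRels D)) :
    annotate .num I.enc = sumTokens I ++ I.constraints.flatMap constraintTokens := by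
  have hticks : ∀ a ∈ List.replicate I.numVars (.tick : CSPSym Γ (constRels D)),
      Phase.num.next a = .num := fun a ha => by rw [List.eq_of_mem_replicate ha]; rfl
  rw [CSPInst.enc, annotate_append_of_fixed hticks, List.map_replicate, annotate_append,
    annotate_flatMap fun q t => annotate_encTerm q t,
    annotate_flatMap fun q c => annotate_encConstraint q c, sumTokens, List.append_assoc]

/-- Case distinction on a token: `rel` for the beginning of a constraint application, `tick` and
`sep` for the notation of its variable, and `lit` for the tokens of the variables and terms. -/
def tokenCases {X : Type} (lit : Phase × CSPSym Γ (constRels D) → X) (rel : constRels D → X)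
    (tick sep : X) : Phase × CSPSym Γ (constRels D) → X
  | (_, .rel R) => rel R
  | (.constr, .tick) => tick
  | (.constr, .sep) => sep
  | a => lit a

theorem tokenCases_rel {X Y : Type} {C : X → Y → Prop}
    {lit : Phase × CSPSym Γ (constRels D) → X} {rel : constRels D → X} {tick sep : X}
    {lit' : Phase × CSPSym Γ (constRels D) → Y} {rel' : constRels D → Y} {tick' sep' : Y}
    (hlit : ∀ a, C (lit a) (lit' a)) (hrel : ∀ R, C (rel R) (rel' R)) (htick : C tick tick')
    (hsep : C sep sep') (a : Phase × CSPSym Γ (constRels D)) :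
    C (tokenCases lit rel tick sep a) (tokenCases lit' rel' tick' sep' a) := by
  rcases a with ⟨_ | _ | _ | _, _ | _ | _ | _ | _⟩
  all_goals first | exact hlit _ | exact hrel _ | exact htick | exact hsep

theorem tokenCases_of_mem_sumTokens {X : Type} {lit : Phase × CSPSym Γ (constRels D) → X}
    {rel : constRels D → X} {tick sep : X} {I : CSPInst Γ (constRels D)}
    {a : Phase × CSPSym Γ (constRels D)} (ha : a ∈ sumTokens I) :
    tokenCases lit rel tick sep a = lit a := by
  simp only [sumTokens, termTokens, CSPInst.encNat, CSPInst.encArgs, List.mem_append,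
    List.mem_replicate, List.mem_flatMap, List.mem_cons, List.mem_map] at ha
  obtain ⟨-, rfl⟩ | ⟨t, -, rfl | ⟨_, ⟨_, -, rfl⟩, rfl⟩ | rfl | ⟨_, ⟨_, -, rfl⟩, rfl⟩ |
    ⟨_, ⟨_, -, rfl | ⟨-, rfl⟩⟩, rfl⟩⟩ := ha <;> rfl

/-- One step of a backward scan: the first component counts the ticks of the variable of the
current constraint application, and `lit` and `con` change the second component. -/
def visit {Y : Type} (lit : Phase × CSPSym Γ (constRels D) → Y → Y)
    (con : constRels D → ℕ → Y → Y) : Phase × CSPSym Γ (constRels D) → ℕ × Y → ℕ × Y :=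
  tokenCases (fun a => Prod.map id (lit a)) (fun R s => (0, con R s.1 s.2))
    (Prod.map (· + 1) id) id

section Visit

variable {Y : Type} (lit : Phase × CSPSym Γ (constRels D) → Y → Y) (con : constRels D → ℕ → Y → Y)

theorem foldr_visit_constraintTokens {n : ℕ} (c : CSPConstraint (constRels D) n) (y : Y) :
    (constraintTokens c).foldr (visit lit con) (0, y) = (0, con c.rel c.constVar y) := by
  have hticks : ∀ m : ℕ, (List.replicate m (Phase.constr, CSPSym.tick)).foldr
      (visit lit con) (0, y) = (m, y) := by
    intro m
    induction m with
    | zero => rfl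
    | succ m ih => rw [List.replicate_succ, List.foldr_cons, ih]; rfl
  rw [constraintTokens, List.foldr_cons, List.foldr_cons, hticks]
  rfl

theorem foldr_visit_enc (I : CSPInst Γ (constRels D)) (y : Y) :
    (annotate .num I.enc).foldr (visit lit con) (0, y) = (0, (sumTokens I).foldr lit
      (I.constraints.foldr (fun c => con c.rel c.constVar) y)) := by
  have hconstraints : (I.constraints.flatMap constraintTokens).foldr (visit lit con) (0, y) =
      (0, I.constraints.foldr (fun c => con c.rel c.constVar) y) := by
    induction I.constraints with
    | nil => rfl
    | cons c l ih =>
      rw [List.flatMap_cons, List.foldr_append, ih, foldr_visit_constraintTokens, List.foldr_cons]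
  rw [annotate_enc, List.foldr_append, hconstraints]
  generalize I.constraints.foldr (fun c => con c.rel c.constVar) y = y'
  have hlit : ∀ a ∈ sumTokens I, visit lit con a = Prod.map id (lit a) := fun a ha =>
    tokenCases_of_mem_sumTokens ha
  generalize sumTokens I = l at hlit ⊢
  induction l with
  | nil => rfl
  | cons a l ih =>
    rw [List.forall_mem_cons] at hlit
    rw [List.foldr_cons, ih hlit.2, hlit.1, List.foldr_cons]
    rfl

end Visit

namespace StackProg

variable {K : Type} [DecidableEq K] {A : K → Type} {σ : Type}

/-- The program of a backward scan: `tick` is run for each tick of the variable of a constraint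
application, and `reset` forgets these ticks after `con` has been run. -/
def visitProg (lit : Phase × CSPSym Γ (constRels D) → StackProg A σ)
    (con : constRels D → StackProg A σ) (tick reset : StackProg A σ) :
    Phase × CSPSym Γ (constRels D) → StackProg A σ :=
  tokenCases lit (fun R => seq (con R) reset) tick skip

theorem Run.scan {Y : Type} {k : K} {I : CSPInst Γ (constRels D)}
    {tok : A k → Phase × CSPSym Γ (constRels D)} {u : List (A k)}
    (hu : u.map tok = (annotate .num I.enc).reverse)
    {lit : Phase × CSPSym Γ (constRels D) → StackProg A σ}
    {con : constRels D → StackProg A σ} {tick reset : StackProg A σ}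
    {lit' : Phase × CSPSym Γ (constRels D) → Y → Y} {con' : constRels D → ℕ → Y → Y}
    {reg : Y → σ} {stk : List (A k) → ℕ → Y → ∀ k, List (A k)} {c : ℕ}
    (hstk : ∀ l l' x y, update (stk l x y) k l' = stk l' x y)
    (hlit : ∀ a l x y, Run (lit a) (reg y) (stk l x y) c (reg (lit' a y)) (stk l x (lit' a y)))
    (hcon : ∀ R l x y, x ≤ I.enc.length →
      Run (con R) (reg y) (stk l x y) c (reg (con' R x y)) (stk l x (con' R x y)))
    (htick : ∀ l x y, Run tick (reg y) (stk l x y) c (reg y) (stk l (x + 1) y))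
    (hreset : ∀ l x y, x ≤ I.enc.length → Run reset (reg y) (stk l x y) c (reg y) (stk l 0 y))
    {y y' : Y} (hy : (sumTokens I).foldr lit'
      (I.constraints.foldr (fun c => con' c.rel c.constVar) y) = y') :
    Run (.forEach k fun a => visitProg lit con tick reset (tok a)) (reg y) (stk u 0 y)
      ((2 * c + 2) * I.enc.length + 1) (reg y') (stk [] 0 y') := by
  have hlength : u.length = I.enc.length := by
    rw [← List.length_map (f := tok), hu, List.length_reverse, length_annotate]
  have hfold : u.foldl (fun s a => visit lit' con' (tok a) s) (0, y) = (0, y') := by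
    rw [← List.foldl_map (f := tok) (g := fun s a => visit lit' con' a s), hu, List.foldl_reverse,
      foldr_visit_enc, hy]
  have hstep : ∀ a s, (visit lit' con' a s).1 ≤ s.1 + 1 ∧ ∀ l, s.1 ≤ I.enc.length →
      Run (visitProg lit con tick reset a) (reg s.2) (stk l s.1 s.2) (2 * c + 1)
        (reg (visit lit' con' a s).2) (stk l (visit lit' con' a s).1 (visit lit' con' a s).2) := by
    intro a
    refine tokenCases_rel (C := fun p (f : ℕ × Y → ℕ × Y) => ∀ s, (f s).1 ≤ s.1 + 1 ∧ ∀ l,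
      s.1 ≤ I.enc.length → Run p (reg s.2) (stk l s.1 s.2) (2 * c + 1) (reg (f s).2)
        (stk l (f s).1 (f s).2)) ?_ ?_ ?_ ?_ a
    · exact fun a s => ⟨Nat.le_succ _, fun l _ => (hlit a l s.1 s.2).mono (by omega)⟩
    · exact fun R s => ⟨Nat.zero_le _, fun l hs =>
        ((hcon R l s.1 s.2 hs).seq (hreset l s.1 _ hs)).mono (by omega)⟩
    · exact fun s => ⟨le_rfl, fun l _ => (htick l s.1 s.2).mono (by omega)⟩
    · exact fun s => ⟨Nat.le_succ _, fun l _ => Run.skip.mono (by omega)⟩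
  have hrun := Run.forEach (p := fun a => visitProg lit con tick reset (tok a))
    (f := fun s a => visit lit' con' (tok a) s) (reg := fun s => reg s.2)
    (stk := fun l s => stk l s.1 s.2) (P := fun l s => s.1 + l.length ≤ I.enc.length)
    (fun l l' s => hstk l l' s.1 s.2)
    (fun a l s hs => by
      have := (hstep (tok a) s).1
      rw [List.length_cons] at hs
      omega)
    (fun a l s hs => (hstep (tok a) s).2 l (by omega)) u (x := (0, y)) (by simp [hlength])
  rwa [hfold, hlength] at hrun

end StackProg

end Scan

namespace ConstReduction

instance {D : Type} {Γ : Set (CostFn D)} {Δ : Set (FinRel D)} [Finite Γ] [Finite Δ] :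
    Finite (CSPSym Γ Δ) := by
  let f : Γ ⊕ Δ ⊕ Bool ⊕ Option Unit → CSPSym Γ Δ :=
    Sum.elim .fn (Sum.elim .rel (Sum.elim .bit fun a => a.elim .tick fun _ => .sep))
  refine Finite.of_surjective f ?_
  rintro (f | R | b | _ | _)
  exacts [⟨.inl f, rfl⟩, ⟨.inr (.inl R), rfl⟩, ⟨.inr (.inr (.inl b)), rfl⟩,
    ⟨.inr (.inr (.inr none)), rfl⟩, ⟨.inr (.inr (.inr (some ()))), rfl⟩]

section Words

theorem flatMap_replicate_of_eq_singleton {A B : Type} {f : A → List B} {a : A} {b : B}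
    (h : f a = [b]) (k : ℕ) : (List.replicate k a).flatMap f = List.replicate k b := by
  induction k with
  | zero => rfl
  | succ k ih =>
    rw [List.replicate_succ, List.flatMap_cons, ih, h, List.singleton_append, List.replicate_succ]

variable {D : Type} {Γ : Set (CostFn D)} {m n : ℕ}

variable (Γ) in
/-- The pieces from which the notation of gadgets is assembled: letters, the unary notation of the
variable of a constraint application, and the zeros in the binary notation of the weight. -/
inductive Piece
  | lit (a : CSPSym Γ ∅)
  | var
  | zeros

/-- The word denoted by a piece, for the variable `x` and the weight `2 ^ L`. -/
def Piece.expand (x L : ℕ) : Piece Γ → List (CSPSym Γ ∅)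
  | .lit a => [a]
  | .var => List.replicate x .tick
  | .zeros => List.replicate L (.bit false)

theorem bits_two_pow (L : ℕ) : (2 ^ L).bits = List.replicate L false ++ [true] := by
  induction L with
  | zero => simp
  | succ L ih =>
    rw [pow_succ', Nat.bit0_bits _ (by positivity), ih, List.replicate_succ, List.cons_append]

/-- The notation of the gadget for a representation, in which `r e` is written for the variable
that represents `e`. -/
noncomputable def gadgetWord [Finite D] [Finite Γ] (r : D → List (Piece Γ)) : List (Piece Γ) :=
  (zeros Γ).flatMap fun p =>
    .lit (.fn p.1) :: .zeros :: .lit (.bit true) :: .lit .sep :: .lit (.bit true) ::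
      (List.ofFn p.2).flatMap fun e => .lit .sep :: r e

theorem flatMap_expand_gadgetWord [Finite D] [Finite Γ] {x : ℕ} (L : ℕ)
    {r : D → List (Piece Γ)} {ρ : D → Fin m}
    (h : ∀ e, (r e).flatMap (Piece.expand x L) = List.replicate (ρ e) .tick) :
    (gadgetWord r).flatMap (Piece.expand x L) =
      (endoGadget (2 ^ L) ρ).flatMap CSPInst.encTerm := by
  have hcast : (2 : ℚ≥0) ^ L = ((2 ^ L : ℕ) : ℚ≥0) := by push_cast; rfl
  have hnum : ((2 : ℚ≥0) ^ L).num = 2 ^ L := by rw [hcast, NNRat.num_natCast]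
  have hden : ((2 : ℚ≥0) ^ L).den = 1 := by rw [hcast, NNRat.den_natCast]
  rw [gadgetWord, endoGadget, List.flatMap_assoc, List.flatMap_map]
  congr 1
  funext p
  have hargs : ((List.ofFn p.2).flatMap fun e => .lit .sep :: r e).flatMap (Piece.expand x L) =
      CSPInst.encArgs (List.ofFn (ρ ∘ p.2)) := by
    rw [List.flatMap_assoc, CSPInst.encArgs, ← List.map_ofFn, List.flatMap_map]
    simp [Piece.expand, h]
  simp [CSPInst.encTerm, CSPInst.encNat, hnum, hden, bits_two_pow, Piece.expand, hargs]

/-- The word written for a token of the variables and terms: in front of the number of each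
variable of a term, the number of new variables is written. -/
noncomputable def litWord : Phase × CSPSym Γ (constRels D) → List (CSPSym Γ ∅)
  | (.args, .sep) => .sep :: List.replicate (Nat.card D) .tick
  | (_, .fn f) => [.fn f]
  | (_, .bit b) => [.bit b]
  | (_, .tick) => [.tick]
  | (_, .sep) => [.sep]
  | (_, .rel _) => []

theorem flatMap_litWord_encNat (q : Phase) (k : ℕ) :
    ((CSPInst.encNat k).map (Prod.mk q)).flatMap (litWord (Γ := Γ)) = CSPInst.encNat k := by
  have hbit : ∀ b, litWord (Γ := Γ) (q, .bit b) = [.bit b] := fun b => by cases q <;> rfl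
  simp only [CSPInst.encNat, List.map_map, List.flatMap_map, comp_apply, hbit]
  exact List.flatMap_pure_eq_map _ _

theorem flatMap_litWord_ticks (q : Phase) (k : ℕ) :
    (List.replicate k (q, CSPSym.tick)).flatMap (litWord (Γ := Γ)) = List.replicate k .tick :=
  flatMap_replicate_of_eq_singleton (by cases q <;> rfl) k

theorem flatMap_litWord_encArgs (l : List (Fin n)) :
    ((CSPInst.encArgs l).map (Prod.mk Phase.args)).flatMap (litWord (Γ := Γ)) =
      CSPInst.encArgs (l.map (Fin.natAdd (Nat.card D))) := by
  simp [CSPInst.encArgs, List.map_flatMap, List.flatMap_assoc, List.flatMap_map, litWord,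
    flatMap_litWord_ticks, List.replicate_append_replicate]

theorem flatMap_litWord_termTokens (t : CSPTerm Γ n) :
    (termTokens t).flatMap litWord =
      CSPInst.encTerm (t.rename (Fin.natAdd (Nat.card D))) := by
  simp [termTokens, litWord, CSPInst.encTerm, flatMap_litWord_encNat, flatMap_litWord_encArgs,
    CSPTerm.rename, List.map_ofFn]

theorem flatMap_litWord_sumTokens (I : CSPInst Γ (constRels D)) :
    (sumTokens I).flatMap litWord = List.replicate I.numVars .tick ++
      (I.terms.map (CSPTerm.rename (Fin.natAdd (Nat.card D)))).flatMap CSPInst.encTerm := by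
  simp only [sumTokens, List.flatMap_append, flatMap_litWord_ticks, List.flatMap_assoc,
    flatMap_litWord_termTokens, List.flatMap_map]

variable [Finite D]

/-- The notation of the new variable that represents `e`. -/
noncomputable def elemWord (e : D) : List (Piece Γ) := List.replicate (idx e) (.lit .tick)

variable [DecidableEq D]

/-- The notation of the variable that represents `e` in a constraint application of `R`. -/
noncomputable def constraintWord (R : constRels D) : D → List (Piece Γ) :=
  update elemWord (constOf R) (List.replicate (Nat.card D) (.lit .tick) ++ [.var])

variable [Finite Γ]

theorem enc_reduceInst (I : CSPInst Γ (constRels D)) :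
    (reduceInst I).enc = List.replicate (Nat.card D) .tick ++ ((sumTokens I).flatMap litWord ++
      (I.constraints.flatMap (fun c =>
        (gadgetWord (constraintWord c.rel)).flatMap (Piece.expand c.constVar I.enc.length)) ++
      (gadgetWord elemWord).flatMap (Piece.expand 0 I.enc.length))) := by
  have helem : ∀ x e, (elemWord e).flatMap (Piece.expand x I.enc.length) =
      List.replicate (elemVar I.numVars e) (CSPSym.tick : CSPSym Γ ∅) := fun x e =>
    flatMap_replicate_of_eq_singleton (a := Piece.lit .tick) rfl _
  have hconstraint : ∀ (c : CSPConstraint (constRels D) I.numVars) e,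
      (constraintWord c.rel e).flatMap (Piece.expand c.constVar I.enc.length) =
        List.replicate (constraintVar c e) (CSPSym.tick : CSPSym Γ ∅) := by
    intro c e
    by_cases he : e = constOf c.rel
    · subst he
      simp [constraintWord, constraintVar, List.flatMap_append, Piece.expand,
        flatMap_replicate_of_eq_singleton (f := Piece.expand _ _) (a := .lit .tick) rfl,
        List.replicate_append_replicate]
    · rw [constraintWord, constraintVar, update_of_ne he, update_of_ne he, helem]
  rw [flatMap_expand_gadgetWord _ (helem 0)]
  simp only [flatMap_expand_gadgetWord _ (hconstraint _)]
  rw [flatMap_litWord_sumTokens]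
  simp [CSPInst.enc, reduceInst, gadgets, representations, List.flatMap_append, List.flatMap_map,
    List.flatMap_assoc, ← List.replicate_append_replicate]

end Words

end ConstReduction

namespace ConstReduction

open StackProg

variable {D : Type} {Γ : Set (CostFn D)}

/-- The stacks of the program that reduces instances: the input, its tokens, the length of the
input, an auxiliary stack, the variable of the current constraint application (both numbers in
unary), and the output. -/
inductive ReduceStack
  | inp | toks | count | tmp | unary | out
  deriving DecidableEq

namespace ReduceStack

instance : Fintype ReduceStack where
  elems := {.inp, .toks, .count, .tmp, .unary, .out}
  complete k := by cases k <;> simp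

variable (Γ) in
/-- The alphabets of the stacks. -/
abbrev Alphabet : ReduceStack → Type
  | inp => CSPSym Γ (constRels D)
  | toks => Phase × CSPSym Γ (constRels D)
  | count => Unit
  | tmp => Unit
  | unary => Unit
  | out => CSPSym Γ ∅

instance [Finite D] [Finite Γ] (k : ReduceStack) : Finite (Alphabet Γ k) := by
  cases k <;> (simp only [Alphabet]; infer_instance)

/-- The contents of the stacks, with `tmp` empty. -/
def contents (w : List (CSPSym Γ (constRels D))) (u : List (Phase × CSPSym Γ (constRels D)))
    (L x : ℕ) (o : List (CSPSym Γ ∅)) : ∀ k, List (Alphabet Γ k)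
  | inp => w
  | toks => u
  | count => List.replicate L ()
  | tmp => []
  | unary => List.replicate x ()
  | out => o

section

variable {w w' : List (CSPSym Γ (constRels D))} {u u' : List (Phase × CSPSym Γ (constRels D))}
  {L x n : ℕ} {o o' : List (CSPSym Γ ∅)}

theorem update_inp : update (contents w u L x o) inp w' = contents w' u L x o := by
  funext k; cases k <;> rfl

theorem update_toks : update (contents w u L x o) toks u' = contents w u' L x o := by
  funext k; cases k <;> rfl

theorem update_count :
    update (contents w u L x o) count (List.replicate n ()) = contents w u n x o := by
  funext k; cases k <;> rfl

theorem update_unary :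
    update (contents w u L x o) unary (List.replicate n ()) = contents w u L n o := by
  funext k; cases k <;> rfl

theorem update_out : update (contents w u L x o) out o' = contents w u L x o' := by
  funext k; cases k <;> rfl

end

end ReduceStack

open ReduceStack

/-- Split the input into tokens and count its letters. -/
def readProg : StackProg (Alphabet Γ) Phase :=
  forEach inp fun a => seq (load fun q => q.next a)
    (seq (case fun q => push toks (q, a)) (push count ()))

theorem run_readProg (w : List (CSPSym Γ (constRels D))) :
    Run readProg .num (contents w [] 0 0 []) (5 * w.length + 1) (w.foldl Phase.next .num)
      (contents [] (annotate .num w).reverse w.length 0 []) := by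
  have hrun := Run.forEach (k := inp) (p := fun a : CSPSym Γ (constRels D) =>
      .seq (.load fun q : Phase => q.next a) (.seq (.case fun q => .push toks (q, a))
        (.push (Γ := Alphabet Γ) count ())))
    (f := fun s a => (s.1.next a, (s.1.next a, a) :: s.2)) (reg := Prod.fst)
    (stk := fun l s => contents l s.2 s.2.length 0 []) (P := fun _ _ => True) (c := 4)
    (fun l l' s => update_inp) (fun _ _ _ _ => trivial) (fun a l s _ => ?_) w
    (x := (.num, [])) trivial
  · rw [foldl_annotate, List.append_nil, List.length_reverse, length_annotate] at hrun
    exact hrun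
  · refine (Run.load.seq ((Run.case (p := fun q => .push (Γ := Alphabet Γ) toks (q, a))
      .push).seq .push)).congr le_rfl rfl ?_
    rw [update_toks]
    exact update_count (n := s.2.length + 1)

/-- Write a piece. -/
def pieceProg : Piece Γ → StackProg (Alphabet Γ) Phase
  | .lit a => push out a
  | .var => pushCopies unary tmp out id id .tick
  | .zeros => pushCopies count tmp out id id (.bit false)

variable (q : Phase) (u : List (Phase × CSPSym Γ (constRels D))) {L x : ℕ}

theorem run_pieceProg (hx : x ≤ L) (p : Piece Γ) (o : List (CSPSym Γ ∅)) :
    Run (pieceProg p) q (contents [] u L x o) (5 * L + 2) q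
      (contents [] u L x (p.expand x L ++ o)) := by
  cases p with
  | lit a => exact Run.push.congr (by omega) rfl update_out
  | var =>
    refine (Run.pushCopies (k := unary) (by decide) (by decide) (by decide) (fun _ => rfl)
      _ q rfl).congr ?_ rfl ?_ <;> rw [contents, List.length_replicate]
    · omega
    · exact update_out
  | zeros =>
    refine (Run.pushCopies (k := count) (by decide) (by decide) (by decide) (fun _ => rfl)
      _ q rfl).congr ?_ rfl ?_ <;> rw [contents, List.length_replicate]
    exact update_out

/-- Write a list of pieces. -/
def wordProg : List (Piece Γ) → StackProg (Alphabet Γ) Phase := pushEach pieceProg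

theorem run_wordProg (hx : x ≤ L) (l : List (Piece Γ)) (o : List (CSPSym Γ ∅)) :
    Run (wordProg l) q (contents [] u L x o) ((5 * L + 2) * l.length + 1) q
      (contents [] u L x (l.flatMap (Piece.expand x L) ++ o)) :=
  Run.pushEach (stk := contents [] u L x) (run_pieceProg q u hx) l o

theorem length_litWord_le (a : Phase × CSPSym Γ (constRels D)) :
    (litWord a).length ≤ Nat.card D + 1 := by
  rcases a with ⟨_ | _ | _ | _, _ | _ | _ | _ | _⟩ <;> simp [litWord]

variable [Finite D] [DecidableEq D] [Finite Γ]

/-- Write the notation of the variables and terms and of the gadgets of the constraint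
applications. -/
noncomputable def tokensProg : StackProg (Alphabet Γ) Phase :=
  forEach toks (visitProg (fun a => pushWord out (litWord a))
    (fun R => wordProg (gadgetWord (constraintWord R))) (push unary ()) (clear unary))

theorem run_tokensProg {M : ℕ} (hM : ∀ R : constRels D,
    (gadgetWord (constraintWord R) : List (Piece Γ)).length ≤ M) (I : CSPInst Γ (constRels D))
    (o : List (CSPSym Γ ∅)) :
    Run tokensProg q (contents [] (annotate .num I.enc).reverse I.enc.length 0 o)
      ((2 * ((M + Nat.card D + 2) * (5 * I.enc.length + 2)) + 2) * I.enc.length + 1) q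
      (contents [] [] I.enc.length 0 ((sumTokens I).flatMap litWord ++
        (I.constraints.flatMap (fun c => (gadgetWord (constraintWord c.rel)).flatMap
          (Piece.expand c.constVar I.enc.length)) ++ o))) := by
  refine Run.scan (Γ := Γ) (I := I) (tok := id) (reg := fun _ => q) (k := toks)
    (stk := fun l => contents [] l I.enc.length)
    (lit' := fun a o => litWord a ++ o)
    (con' := fun R x o => (gadgetWord (constraintWord R)).flatMap
      (Piece.expand x I.enc.length) ++ o) (List.map_id _) (fun l l' x o => update_toks)
    (fun a l x o => ?_) (fun R l x o hx => ?_) (fun l x o => ?_) (fun l x o hx => ?_) ?_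
  · have := length_litWord_le a
    exact (Run.pushWord _ _ _ _).congr (by nlinarith) rfl update_out
  · have := hM R
    exact (run_wordProg q l hx _ _).mono (by nlinarith)
  · exact Run.push.congr (by nlinarith) rfl (update_unary (n := x + 1))
  · refine (Run.clear _ _ _).congr ?_ rfl (update_unary (n := 0))
    rw [contents, List.length_replicate]
    nlinarith
  · simp [List.foldr_append_eq_append, List.flatMap_def]

/-- The program that reduces instances. -/
noncomputable def reduceProg : StackProg (Alphabet Γ) Phase :=
  seq readProg (seq (wordProg (gadgetWord elemWord)) (seq tokensProg
    (seq (pushWord out (List.replicate (Nat.card D) .tick))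
      (seq (clear count) (load fun _ => .num)))))

theorem polyTimeComputable_reduceInst :
    PolyTimeComputable (CSPInst.enc (Γ := Γ) (Δ := constRels D)) CSPInst.enc reduceInst := by
  obtain ⟨M, hM⟩ := Finite.exists_le fun R : Option (constRels D) =>
    (gadgetWord (R.elim elemWord constraintWord) : List (Piece Γ)).length
  refine polyTimeComputable (k₀ := inp) (k₁ := out) reduceProg .num (30 * (M + Nat.card D + 2))
    2 fun I => ?_
  have hinit : update (β := fun k => List (Alphabet Γ k)) (fun _ => []) inp I.enc =
      contents I.enc [] 0 0 [] := by
    funext k; cases k <;> rfl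
  have hfinal : update (β := fun k => List (Alphabet Γ k)) (fun _ => []) out (reduceInst I).enc =
      contents [] [] 0 0 (reduceInst I).enc := by
    funext k; cases k <;> rfl
  rw [hinit, hfinal, enc_reduceInst]
  have hM₀ : (gadgetWord elemWord : List (Piece Γ)).length ≤ M := hM none
  refine ((run_readProg I.enc).seq ((run_wordProg _ _ (Nat.zero_le _) _ _).seq
    ((run_tokensProg _ (fun R => hM (some R)) I _).seq ((Run.pushWord _ _ _ _).seq
      ((Run.clear _ _ _).seq Run.load))))).congr ?_ rfl ?_
  · simp only [update_out, contents, List.length_replicate]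
    generalize (gadgetWord elemWord : List (Piece Γ)).length = m at hM₀ ⊢
    nlinarith [Nat.mul_le_mul_left (5 * I.enc.length + 2) hM₀,
      Nat.zero_le (I.enc.length * (M + Nat.card D)),
      Nat.zero_le (I.enc.length * I.enc.length * (M + Nat.card D))]
  · rw [update_out]
    simp only [contents, List.append_nil]
    exact update_count (n := 0)

end ConstReduction

namespace ConstReduction

open StackProg

variable {D : Type} {Γ : Set (CostFn D)}

/-- The stacks of the program that recovers solutions: the input, the tokens of the instance, a row
of values divided into a left part, which is stored backwards, and a right part, and the output. -/
inductive RecoverStack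
  | inp | toks | left | right | out
  deriving DecidableEq

namespace RecoverStack

instance : Fintype RecoverStack where
  elems := {.inp, .toks, .left, .right, .out}
  complete k := by cases k <;> simp

variable (Γ) in
/-- The alphabets of the stacks. -/
abbrev Alphabet : RecoverStack → Type
  | inp => CSPSym Γ (constRels D) ⊕ D
  | toks => Phase × CSPSym Γ (constRels D)
  | left => D
  | right => D
  | out => Option D

instance [Finite D] [Finite Γ] (k : RecoverStack) : Finite (Alphabet Γ k) := by
  cases k <;> (simp only [Alphabet]; infer_instance)

/-- The contents of the stacks. -/
def contents (w : List (CSPSym Γ (constRels D) ⊕ D)) (u : List (Phase × CSPSym Γ (constRels D)))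
    (l r : List D) (o : List (Option D)) : ∀ k, List (Alphabet Γ k)
  | inp => w
  | toks => u
  | left => l
  | right => r
  | out => o

variable (D) in
/-- The register: the part of the instance that is being read, the values of the variables that
represent the elements of the domain, and whether the constraint applications are satisfied. -/
abbrev Register : Type := Phase × (D → D) × Bool

section

variable {w w' : List (CSPSym Γ (constRels D) ⊕ D)} {u u' : List (Phase × CSPSym Γ (constRels D))}
  {l l' r r' : List D} {o o' : List (Option D)}

theorem update_inp : update (contents w u l r o) inp w' = contents w' u l r o := by
  funext k; cases k <;> rfl

theorem update_toks : update (contents w u l r o) toks u' = contents w u' l r o := by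
  funext k; cases k <;> rfl

theorem update_left : update (contents w u l r o) left l' = contents w u l' r o := by
  funext k; cases k <;> rfl

theorem update_right : update (contents w u l r o) right r' = contents w u l r' o := by
  funext k; cases k <;> rfl

theorem update_out : update (contents w u l r o) out o' = contents w u l r o' := by
  funext k; cases k <;> rfl

end

end RecoverStack

open RecoverStack

variable (v : Register D) (u : List (Phase × CSPSym Γ (constRels D))) (l r : List D)
  (o : List (Option D))

theorem run_move_left_right :
    Run (move left right id) v (contents [] u l r o) (2 * l.length + 1) v
      (contents [] u [] (l.reverse ++ r) o) := by
  refine (Run.move (Γ := Alphabet Γ) (k := left) (k' := right) (by decide) id v _).congr le_rfl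
    rfl ?_
  rw [update_left, update_right, List.map_id]
  rfl

theorem run_move_right_left (f : D → D) :
    Run (move right left f) v (contents [] u l r o) (2 * r.length + 1) v
      (contents [] u ((r.map f).reverse ++ l) [] o) := by
  refine (Run.move (Γ := Alphabet Γ) (k := right) (k' := left) (by decide) f v _).congr le_rfl
    rfl ?_
  rw [update_right, update_left]
  rfl

/-- Store a letter of the input, with its phase if it belongs to the instance. -/
def storeProg : CSPSym Γ (constRels D) ⊕ D → StackProg (Alphabet Γ) (Register D)
  | .inl a => seq (load (Prod.map (Phase.next · a) id)) (case fun v => push toks (v.1, a))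
  | .inr d => push left d

/-- Split the input into the tokens of the instance and the values of a solution. -/
def splitProg : StackProg (Alphabet Γ) (Register D) := forEach inp storeProg

theorem run_splitProg (w : List (CSPSym Γ (constRels D))) (s : List D) (x : (D → D) × Bool) :
    Run splitProg (.num, x) (contents (w.map Sum.inl ++ s.map Sum.inr) [] [] [] [])
      (4 * (w.length + s.length) + 1) (w.foldl Phase.next .num, x)
      (contents [] (annotate .num w).reverse s.reverse [] []) := by
  let step (y : (Phase × List (Phase × CSPSym Γ (constRels D))) × List D) :
      CSPSym Γ (constRels D) ⊕ D → (Phase × List (Phase × CSPSym Γ (constRels D))) × List D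
    | .inl a => ((y.1.1.next a, (y.1.1.next a, a) :: y.1.2), y.2)
    | .inr d => (y.1, d :: y.2)
  have hfold : (w.map Sum.inl ++ s.map Sum.inr).foldl step ((.num, []), []) =
      ((w.foldl Phase.next .num, (annotate .num w).reverse), s.reverse) := by
    rw [List.foldl_append, List.foldl_map, List.foldl_map,
      List.foldl_hom (fun y => (y, [])) (fun _ _ => rfl), foldl_annotate,
      List.foldl_hom (fun l => (_, l)) (fun _ _ => rfl), List.foldl_flip_cons_eq_append',
      List.append_nil, List.append_nil]
  have hrun := Run.forEach (k := inp) (p := storeProg) (f := step) (reg := fun y => (y.1.1, x))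
    (stk := fun l y => contents l y.1.2 y.2 [] []) (P := fun _ _ => True) (c := 3)
    (fun l l' y => update_inp) (fun _ _ _ _ => trivial) (fun a l y _ => ?_)
    (w.map Sum.inl ++ s.map Sum.inr) (x := ((Phase.num, []), [])) trivial
  · rw [hfold, List.length_append, List.length_map, List.length_map] at hrun
    exact hrun
  · cases a with
    | inl a => exact (Run.load.seq (Run.case (p := fun v : Register D =>
        .push (Γ := Alphabet Γ) toks (v.1, a)) .push)).congr le_rfl rfl update_toks
    | inr d => exact Run.push.congr (by omega) rfl update_left

/-- Read the values at the given elements of the domain into the register. -/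
def readValuesProg [DecidableEq D] : List D → StackProg (Alphabet Γ) (Register D)
  | [] => skip
  | e :: es => seq
    (pop right fun a => load (Prod.map id (Prod.map (fun g => update g e (a.getD e)) id)))
    (readValuesProg es)

theorem run_readValuesProg [DecidableEq D] {f g : D → D} {es : List D}
    (hg : ∀ e ∉ es, g e = f e) (q : Phase) (b : Bool) :
    Run (readValuesProg es) (q, g, b) (contents [] u l (es.map f ++ r) o) (2 * es.length + 1)
      (q, f, b) (contents [] u l r o) := by
  induction es generalizing g with
  | nil =>
    obtain rfl : g = f := funext fun e => hg e List.not_mem_nil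
    exact Run.skip
  | cons e es ih =>
    have hg' : ∀ e' ∉ es, update g e (f e) e' = f e' := by
      intro e' he'
      obtain rfl | hne := eq_or_ne e' e
      · exact update_self _ _ _
      · rw [update_of_ne hne, hg e' (List.not_mem_cons_of_ne_of_not_mem hne he')]
    exact ((Run.pop (Run.load.congr le_rfl rfl update_right)).seq (ih hg')).mono
      (by rw [List.length_cons]; omega)

/-- Translate the values by a left inverse of the map in the register. -/
noncomputable def translateProg : StackProg (Alphabet Γ) (Register D) :=
  seq (case fun v => move right left (extend v.2.1 id id)) (move left right id)

theorem run_translateProg (q : Phase) (g : D → D) (b : Bool) :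
    Run translateProg (q, g, b) (contents [] u [] r o) (4 * r.length + 3) (q, g, b)
      (contents [] u [] (r.map (extend g id id)) o) := by
  refine ((Run.case (run_move_right_left (q, g, b) u [] r o _)).seq
    (run_move_left_right _ u _ [] o)).congr ?_ rfl ?_
  · simp only [List.append_nil, List.length_reverse, List.length_map]
    omega
  · simp

/-- Check the constraint applications against the values on `right`. -/
noncomputable def checkProg [DecidableEq D] : StackProg (Alphabet Γ) (Register D) :=
  forEach toks (visitProg (fun _ => skip)
    (fun R => peek right fun a v => (v.1, v.2.1, v.2.2 && decide (a = some (constOf R))))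
    (pop right fun a => pushWord left a.toList) (move left right id))

theorem foldr_constraints [DecidableEq D] (I : CSPInst Γ (constRels D)) (σ : Fin I.numVars → D) :
    I.constraints.foldr (fun c b =>
      b && decide ((List.ofFn σ)[(c.constVar : ℕ)]? = some (constOf c.rel))) true =
      decide (I.IsSol σ) := by
  have hfoldr : ∀ l : List (CSPConstraint (constRels D) I.numVars), l.foldr (fun c b =>
      b && decide ((List.ofFn σ)[(c.constVar : ℕ)]? = some (constOf c.rel))) true =
      decide (∀ c ∈ l, σ c.constVar = constOf c.rel) := by
    intro l
    induction l with
    | nil => simp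
    | cons c l ih => rw [List.foldr_cons, ih]; simp [Bool.and_comm]
  exact (hfoldr _).trans (decide_eq_decide.2 CSPInst.isSol_iff.symm)

theorem run_checkProg [DecidableEq D] (I : CSPInst Γ (constRels D)) (σ : Fin I.numVars → D)
    (q : Phase) (g : D → D) :
    Run checkProg (q, g, true)
      (contents [] (annotate .num I.enc).reverse [] (List.ofFn σ) [])
      ((2 * (2 * I.enc.length + 4) + 2) * I.enc.length + 1) (q, g, decide (I.IsSol σ))
      (contents [] [] [] (List.ofFn σ) []) := by
  refine Run.scan (Γ := Γ) (I := I) (tok := id) (k := toks) (reg := fun b => (q, g, b))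
    (stk := fun u x _ => contents [] u ((List.ofFn σ).take x).reverse ((List.ofFn σ).drop x) [])
    (lit' := fun _ => id) (con' := fun R x b =>
      b && decide ((List.ofFn σ)[x]? = some (constOf R))) (List.map_id _)
    (fun _ _ _ _ => update_toks) (fun _ u x b => ?_) (fun R u x b _ => ?_) (fun u x b => ?_)
    (fun u x b hx => ?_) ?_
  · exact Run.skip.mono (by omega)
  · refine (Run.peek _ _ _ _).congr (by omega) ?_ rfl
    rw [contents, List.head?_drop]
  · refine (Run.pop (Run.pushWord _ _ _ _)).congr ?_ rfl ?_
    · have := Option.length_toList_le (o := ((List.ofFn σ).drop x).head?)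
      rw [contents]
      omega
    · rw [update_right, update_left, contents, contents, List.head?_drop, List.tail_drop,
        List.take_add_one, List.reverse_append]
      cases (List.ofFn σ)[x]? <;> rfl
  · refine (run_move_left_right _ u _ _ []).congr ?_ rfl ?_
    · rw [List.length_reverse, List.length_take]
      omega
    · rw [List.reverse_reverse, List.take_append_drop, List.take_zero, List.drop_zero,
        List.reverse_nil]
  · rw [foldr_constraints]
    exact List.foldr_fixed _

/-- Write the translated values if they satisfy the constraint applications, `none` otherwise. -/
def answerProg : StackProg (Alphabet Γ) (Register D) :=
  case fun v => if v.2.2 then seq (move right left id) (move left out some)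
    else seq (clear right) (push out none)

theorem run_answerProg (q : Phase) (g : D → D) (b : Bool) :
    Run (answerProg (Γ := Γ)) (q, g, b) (contents [] u [] r []) (4 * r.length + 3) (q, g, b)
      (contents [] u [] [] (if b then r.map some else [none])) := by
  refine Run.case ?_
  cases b with
  | true =>
    refine ((run_move_right_left _ u [] r [] id).seq
      (Run.move (Γ := Alphabet Γ) (k := left) (k' := out) (by decide) some _ _)).congr ?_ rfl ?_
    · simp only [contents, List.map_id, List.append_nil, List.length_reverse]
      omega
    · rw [update_left, update_out]
      simp [contents]
  | false =>
    refine ((Run.clear right _ _).seq .push).congr (by simp only [contents]; omega) rfl ?_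
    rw [update_right, update_out]
    rfl

theorem ofFn_eq_append [Finite D] {n : ℕ} (s : Fin (Nat.card D + n) → D) :
    List.ofFn s = (List.ofFn idx.symm).map (s ∘ elemVar n) ++ List.ofFn (s ∘ Fin.natAdd _) := by
  rw [List.ofFn_add, List.map_ofFn]
  congr 2
  funext i
  rw [comp_apply, comp_apply, elemVar, Equiv.apply_symm_apply]
  rfl

variable [Finite D] [DecidableEq D]

/-- The program that recovers solutions. -/
noncomputable def recoverProg : StackProg (Alphabet Γ) (Register D) :=
  seq splitProg (seq (move left right id) (seq (readValuesProg (List.ofFn idx.symm))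
    (seq translateProg (seq checkProg (seq answerProg (load fun _ => (.num, id, true)))))))

theorem run_recoverProg (I : CSPInst Γ (constRels D)) (s : Fin (Nat.card D + I.numVars) → D) :
    Run recoverProg (.num, id, true)
      (contents (I.enc.map Sum.inl ++ (List.ofFn s).map Sum.inr) [] [] [] [])
      (20 * (I.enc.length + (Nat.card D + I.numVars) + 1) ^ 2) (.num, id, true)
      (contents [] [] [] [] ((recoverSol I s).elim [none] fun σ => (List.ofFn σ).map some)) := by
  have hrestore : (List.ofFn s).reverse.reverse ++ [] =
      (List.ofFn idx.symm).map (s ∘ elemVar I.numVars) ++ List.ofFn (s ∘ Fin.natAdd _) := by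
    rw [List.reverse_reverse, List.append_nil, ofFn_eq_append]
  have hcover : ∀ e ∉ List.ofFn (idx (D := D)).symm, id e = (s ∘ elemVar I.numVars) e :=
    fun e he => absurd (List.mem_ofFn.2 (idx.symm.surjective e)) he
  have hpullBack : (List.ofFn (s ∘ Fin.natAdd _)).map (extend (s ∘ elemVar I.numVars) id id) =
      List.ofFn (pullBack s) := List.map_ofFn
  refine ((run_splitProg I.enc (List.ofFn s) _).seq
    (((run_move_left_right _ _ _ _ _).congr le_rfl rfl (congrArg (contents _ _ _ · _) hrestore)).seq
    ((run_readValuesProg _ _ _ _ hcover _ _).seq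
    (((run_translateProg _ _ _ _ _ _).congr le_rfl rfl
      (congrArg (contents _ _ _ · _) hpullBack)).seq
    ((run_checkProg I _ _ _).seq ((run_answerProg _ _ _ _ _).seq Run.load)))))).congr ?_ rfl ?_
  · simp only [List.length_reverse, List.length_ofFn]
    nlinarith
  · rw [recoverSol]
    split_ifs <;> simp_all

theorem polyTimeComputable_recoverSol [Finite Γ] :
    PolyTimeComputable
      (MinProblem.encPair (MinCSPWith Γ (constRels D)) (MinCSP Γ) reduceInst)
      (MinCSPWith Γ (constRels D)).encAnswer (fun p => ⟨p.1, recoverSol p.1 p.2⟩) := by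
  refine polyTimeComputable (k₀ := inp) (k₁ := out) recoverProg (.num, id, true) 20 2
    fun ⟨I, s⟩ => ?_
  change Fin (Nat.card D + I.numVars) → D at s
  have hinit : update (β := fun k => List (Alphabet Γ k)) (fun _ => []) inp
      (MinProblem.encPair (MinCSPWith Γ (constRels D)) (MinCSP Γ) reduceInst ⟨I, s⟩) =
        contents (I.enc.map Sum.inl ++ (List.ofFn s).map Sum.inr) [] [] [] [] := by
    funext k; cases k <;> rfl
  have hfinal : update (β := fun k => List (Alphabet Γ k)) (fun _ => []) out
      ((MinCSPWith Γ (constRels D)).encAnswer ⟨I, recoverSol I s⟩) =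
        contents [] [] [] [] ((recoverSol I s).elim [none] fun σ => (List.ofFn σ).map some) := by
    cases recoverSol I s <;> funext k <;> cases k <;> rfl
  have hlength : (MinProblem.encPair (MinCSPWith Γ (constRels D)) (MinCSP Γ) reduceInst
      ⟨I, s⟩).length = I.enc.length + (Nat.card D + I.numVars) := by
    change (I.enc.map Sum.inl ++ (List.ofFn s).map Sum.inr).length = _
    simp
  rw [hinit, hfinal]
  exact (run_recoverProg I s).mono (congrArg (fun n => 20 * (n + 1) ^ 2) hlength.symm).le

end ConstReduction

theorem proposition5 {D : Type} [Finite D] (Γ : Set (CostFn D)) (hΓ : Γ.Finite)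
    (hcore : IsCore Γ) :
    MinProblem.PolyTimeReducible (MinCSPWith Γ (constRels D)) (MinCSP Γ) := by
  classical
  have : Finite Γ := hΓ.to_subtype
  refine ⟨ConstReduction.reduceInst, fun I s => ConstReduction.recoverSol I s,
    ConstReduction.polyTimeComputable_reduceInst, ConstReduction.polyTimeComputable_recoverSol,
    fun I => ⟨fun ⟨σ, _⟩ => ?_, fun s hs => ⟨?_, fun hunsat => ?_⟩⟩⟩
  · exact ⟨Fin.append ConstReduction.idx.symm σ, ConstReduction.isSol_reduceInst I _⟩
  · exact ConstReduction.isOptSol_recoverSol hcore hs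
  · exact ConstReduction.recoverSol_eq_none hunsat s
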